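/- Let $k$ be a field of arbitrary characteristic and let $d\ge 1$. Let $\mathcal O$ be a totally rational complete curve singularity ring with $d$ branches: a local $k$-subalgebra of finite codimension of $\widetilde{\mathcal O}=k[[t_1]]\times\cdots\times k[[t_d]]$ (for example the completed local ring of an algebraic curve over $k$ at a closed point such that all points of the normalization above it have residue field $k$, embedded in the completion of its normalization). For $\underline z=(z_1,\dots,z_d)\in\widetilde{\mathcal O}$ put $\underline v(\underline z)=(\operatorname{ord}_{t_1}z_1,\dots,\operatorname{ord}_{t_d}z_d)$. Let $S=\{\underline v(\underline z): \underline z\in\mathcal O \text{ with all } z_i\neq 0\}\subseteq\mathbb N^d$ be the semigroup of values, $\underline c\in\mathbb N^d$ its conductor, i.e. the minimal element (for the product order) with $\underline c+\mathbb N^d\subseteq S$, put $\|\underline c\|=c_1+\dots+c_d$, and let $\delta=\dim_k\widetilde{\mathcal O}/\mathcal O$. Let $\mathcal J=\widetilde{\mathcal O}^\times/\mathcal O^\times$, regarded as an algebraic group over $k$ (it represents $R\mapsto\widetilde{\mathcal O}_R^\times/\mathcal O_R^\times$ on $k$-algebras, where $\widetilde{\mathcal O}_R=R[[t_1]]\times\cdots\times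 R[[t_d]]$ and $\mathcal O_R\subseteq\widetilde{\mathcal O}_R$ is cut out by the $k$-linear equations in the coefficients that define $\mathcal O$). Let $K_0(\mathrm{Var}_k)$ be the Grothendieck ring of $k$-varieties, $\mathbb L=[\mathbb A^1_k]$ and $\mathcal M_k=K_0(\mathrm{Var}_k)[\mathbb L^{-1}]$. For $\underline n\in\mathbb N^d$ let $\pi_{\underline n}$ be the projection to the $\underline n$-jets $J^{\underline n}=\widetilde{\mathcal O}/(t_1^{n_1+1},\dots,t_d^{n_d+1})\widetilde{\mathcal O}$. A subset $X$ of the projectivization $\mathbb P\widetilde{\mathcal O}$ is cylindric if $X=\pi_{\underline n}^{-1}(Y)$ for some $\underline n$ and some constructible $Y\subseteq\mathbb P J^{\underline n}$, and then its generalized Euler characteristic is $\chi_g(X)=[Y]\,\mathbb L^{-\|\underline n+\underline 1\|}\in\mathcal M_k$. Here sets are understood geometrically: they consist of points with coordinates in an algebraically closed extension $K$ of $k$, and the conditions defining constructible sets have coefficients in $k$. The generalized Poincaré series is $$P_g(T_1,\dots,T_d,\mathcal O)=\int_{\mathbb P\mathcal O}T^{\underline v(\underline z)}\,d\chi_g=\sum_{\underline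 n\in\mathbb N^d}\chi_g\bigl(\{[\underline z]\in\mathbb P\mathcal O:\underline v(\underline z)=\underline n\}\bigr)\,T_1^{n_1}\cdots T_d^{n_d}\in\mathcal M_k[[T_1,\dots,T_d]],$$ where $T^{\underline v(\underline z)}:=0$ if some $z_i=0$. Then the integral is well defined (the function $T^{\underline v(\underline z)}$ is integrable over $\mathbb P\mathcal O$), the algebraic group $\mathcal J$ exists as an affine $k$-variety, and $P_g$ is a rational function of the form $$P_g(T_1,\dots,T_d,\mathcal O)=\frac{Q(T_1,\dots,T_d)}{\prod_{i=1}^d(1-\mathbb L^{-1}T_i)},$$ where $Q\in\mathcal M_k[T_1,\dots,T_d]$ is a polynomial of (total) degree at most $\|\underline c\|$ that satisfies $Q(\mathbb L,\dots,\mathbb L)=\mathbb L^{-\delta-1}[\mathcal J]$. -/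

import Mathlib

open AlgebraicGeometry CategoryTheory

universe u

/-! ## The Grothendieck ring of varieties -/

/-- A `k`-variety: a separated scheme of finite type over `Spec k`. (Non-reduced schemes are
allowed, so that fibre products stay inside the class; the closed immersion `V_red → V` has empty
complement, so `[V] = [V_red]` in the Grothendieck ring.) -/
structure KVariety (k : Type u) [Field k] where
  /-- the underlying scheme over `Spec k` -/
  toOver : Over (Spec (CommRingCat.of k))
  locallyOfFiniteType : LocallyOfFiniteType toOver.hom
  quasiCompact : QuasiCompact toOver.hom
  isSeparated : IsSeparated toOver.hom

/-- The affine `k`-variety `Spec A` of a finitely generated `k`-algebra `A`. -/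
noncomputable def KVariety.affine (k : Type u) [Field k] (A : Type u) [CommRing A] [Algebra k A]
    [Algebra.FiniteType k A] : KVariety k where
  toOver := Over.mk (Spec.map (CommRingCat.ofHom (algebraMap k A)))
  locallyOfFiniteType := by
    refine (HasRingHomProperty.Spec_iff (P := @LocallyOfFiniteType)).2 ?_
    exact (RingHom.finiteType_algebraMap (A := k) (B := A)).2 inferInstance
  quasiCompact := by dsimp; infer_instance
  isSeparated := by dsimp; infer_instance

/-- The defining relations of the Grothendieck ring, as elements of the free commutative ring on
all `k`-varieties. -/
inductive GrothendieckRel (k : Type u) [Field k] : FreeCommRing (KVariety k) → Prop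
  /-- isomorphic varieties have the same class -/
  | iso (V W : KVariety k) (e : V.toOver ≅ W.toOver) :
      GrothendieckRel k (FreeCommRing.of V - FreeCommRing.of W)
  /-- `[V] = [V ∖ Z] + [Z]` for `Z` closed in `V` -/
  | scissor (V U Z : KVariety k) (j : U.toOver ⟶ V.toOver) (i : Z.toOver ⟶ V.toOver)
      (hj : IsOpenImmersion j.left) (hi : IsClosedImmersion i.left)
      (h : Set.range j.left = (Set.range i.left)ᶜ) :
      GrothendieckRel k (FreeCommRing.of V - (FreeCommRing.of U + FreeCommRing.of Z))
  /-- `[V × W] = [V] [W]` -/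
  | prod (V W P : KVariety k) (p : P.toOver.left ⟶ V.toOver.left)
      (q : P.toOver.left ⟶ W.toOver.left)
      (hP : IsPullback p q V.toOver.hom W.toOver.hom) (hp : p ≫ V.toOver.hom = P.toOver.hom) :
      GrothendieckRel k (FreeCommRing.of P - FreeCommRing.of V * FreeCommRing.of W)
  /-- the class of a point is `1` -/
  | point : GrothendieckRel k (FreeCommRing.of (KVariety.affine k k) - 1)

/-- The Grothendieck ring `K₀(Var_k)`. -/
abbrev GrothendieckRing (k : Type u) [Field k] : Type (u + 1) :=
  FreeCommRing (KVariety k) ⧸ Ideal.span {x | GrothendieckRel k x}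

/-- The class `[V]` of a variety in `K₀(Var_k)`. -/
noncomputable def KVariety.cls {k : Type u} [Field k] (V : KVariety k) : GrothendieckRing k :=
  Ideal.Quotient.mk _ (FreeCommRing.of V)

/-- The class of the affine line in `K₀(Var_k)`. -/
noncomputable def affineLineClass (k : Type u) [Field k] : GrothendieckRing k :=
  (KVariety.affine k (Polynomial k)).cls

/-- The localization `ℳ_k = K₀(Var_k)[𝕃⁻¹]`. -/
abbrev MotivicRing (k : Type u) [Field k] : Type (u + 1) :=
  Localization.Away (affineLineClass k)

/-- The image in `ℳ_k` of an element of `K₀(Var_k)`. -/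
noncomputable def toMotivic (k : Type u) [Field k] : GrothendieckRing k →+* MotivicRing k :=
  algebraMap _ _

/-- `𝕃 = [𝔸¹]`, as a unit of `ℳ_k`. -/
noncomputable def lefschetz (k : Type u) [Field k] : (MotivicRing k)ˣ :=
  (IsLocalization.Away.algebraMap_isUnit (S := MotivicRing k) (affineLineClass k)).unit

/-! ## Constructible subsets of projective space and their classes

Sets are sets of points with coordinates in an algebraically closed extension `K` of `k`; the
conditions defining constructible sets have coefficients in `k`, and their classes are classes
of `k`-varieties. -/

/-- A condition `p = 0` for all `p ∈ I`, `q ≠ 0`, with coefficients in `k`, on the points of the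
affine space with coordinates indexed by `σ`. -/
structure BasicCondition (k : Type u) [Field k] (σ : Type) where
  /-- the polynomials that vanish -/
  I : Ideal (MvPolynomial σ k)
  /-- the polynomial that does not vanish -/
  q : MvPolynomial σ k

namespace BasicCondition

variable {k : Type u} [Field k] {σ : Type}

/-- The `K`-points satisfying the condition. -/
def points (B : BasicCondition k σ) (K : Type u) [Field K] [Algebra k K] : Set (σ → K) :=
  {x | (∀ p ∈ B.I, MvPolynomial.aeval x p = 0) ∧ MvPolynomial.aeval x B.q ≠ 0}

/-- The coordinate ring `(k[x] / I)_q` of the locally closed subscheme `V(I) ∖ V(q)`. -/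
abbrev coordRing (B : BasicCondition k σ) : Type u :=
  Localization.Away (Ideal.Quotient.mk B.I B.q)

/-- The coordinate ring is finitely generated over `k`. -/
theorem finiteType_coordRing [Finite σ] (B : BasicCondition k σ) :
    Algebra.FiniteType k B.coordRing :=
  haveI : Algebra.FiniteType (MvPolynomial σ k ⧸ B.I) B.coordRing :=
    IsLocalization.finiteType_of_monoid_fg (Submonoid.powers (Ideal.Quotient.mk B.I B.q)) _
  Algebra.FiniteType.trans (S := MvPolynomial σ k ⧸ B.I) inferInstance inferInstance

/-- The class in `K₀(Var_k)` of the locally closed subscheme `V(I) ∖ V(q)` of affine space. -/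
noncomputable def cls [Finite σ] (B : BasicCondition k σ) : GrothendieckRing k :=
  haveI := B.finiteType_coordRing
  (KVariety.affine k B.coordRing).cls

end BasicCondition

/-- `Y ⊆ ℙ(K^σ)` is constructible over `k` and its class is `[Y] = a`: the set `Y` is a finite
disjoint union of pieces, each of which is a locally closed subset, defined over `k`, of one of
the standard affine charts `{x_s = 1}` of the projective space, and `a` is the sum of the classes
of the pieces. -/
def HasClass {k : Type u} [Field k] {K : Type u} [Field K] [Algebra k K] {σ : Type} [Finite σ]
    (Y : Set (Projectivization K (σ → K))) (a : GrothendieckRing k) : Prop :=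
  ∃ (m : ℕ) (s : Fin m → σ) (B : Fin m → BasicCondition k σ) (Z : Fin m → Set (Projectivization K (σ → K))),
    (∀ i, MvPolynomial.X (s i) - 1 ∈ (B i).I) ∧
    (∀ i, Z i = {y | ∃ x ∈ (B i).points K, ∃ h : x ≠ 0, y = Projectivization.mk K x h}) ∧
    Pairwise (fun i j => Disjoint (Z i) (Z j)) ∧
    Y = ⋃ i, Z i ∧
    a = ∑ i, (B i).cls

/-! ## The projectivization of `K⟦t₁⟧ × ⋯ × K⟦t_d⟧` and its motivic measure -/

/-- The ring `R⟦t₁⟧ × ⋯ × R⟦t_d⟧`. -/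
abbrev BranchRing (d : ℕ) (R : Type u) [CommRing R] : Type u := Fin d → PowerSeries R

/-- The coordinates of the space of `n`-jets: the coefficients of `t_i ^ j` with `j ≤ n i`. -/
abbrev JetIndex {d : ℕ} (n : Fin d → ℕ) : Type := Σ i : Fin d, Fin (n i + 1)

/-- The `n`-jet of an element of `K⟦t₁⟧ × ⋯ × K⟦t_d⟧`. -/
noncomputable def jet {d : ℕ} {K : Type u} [Field K] (n : Fin d → ℕ) (z : BranchRing d K) :
    JetIndex n → K :=
  fun p => PowerSeries.coeff (p.2 : ℕ) (z p.1)

/-- The cylinder over a set `Y` of projective `n`-jets. -/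
def projCylinder {d : ℕ} {K : Type u} [Field K] (n : Fin d → ℕ)
    (Y : Set (Projectivization K (JetIndex n → K))) : Set (Projectivization K (BranchRing d K)) :=
  {x | ∃ h : jet n x.rep ≠ 0, Projectivization.mk K (jet n x.rep) h ∈ Y}

/-- `X ⊆ ℙ(K⟦t₁⟧ × ⋯ × K⟦t_d⟧)` is the cylinder over a constructible set `Y` of projective
`n`-jets, and `a = [Y] 𝕃 ^ (-‖n + 1‖)`. -/
def HasMotivicMeasure {k : Type u} [Field k] {d : ℕ} {K : Type u} [Field K] [Algebra k K]
    (X : Set (Projectivization K (BranchRing d K))) (a : MotivicRing k) : Prop :=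
  ∃ (n : Fin d → ℕ) (Y : Set (Projectivization K (JetIndex n → K))) (b : GrothendieckRing k),
    X = projCylinder n Y ∧ HasClass Y b ∧
    a = toMotivic k b * ((lefschetz k)⁻¹ ^ (∑ i, (n i + 1)) : (MotivicRing k)ˣ)

/-- A set of points of `ℙ(K⟦t₁⟧ × ⋯ × K⟦t_d⟧)` is cylindric (over `k`) if it is the cylinder over
a constructible set of projective jets. -/
def IsCylindric (k : Type u) [Field k] {d : ℕ} {K : Type u} [Field K] [Algebra k K]
    (X : Set (Projectivization K (BranchRing d K))) : Prop :=
  ∃ a : MotivicRing k, HasMotivicMeasure X a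

open Classical in
/-- The generalized Euler characteristic (motivic measure) `χ_g(X) ∈ ℳ_k` of a cylindric set. -/
noncomputable def genEulerChar (k : Type u) [Field k] {d : ℕ} {K : Type u} [Field K] [Algebra k K]
    (X : Set (Projectivization K (BranchRing d K))) : MotivicRing k :=
  if h : IsCylindric k X then h.choose else 0

/-- Integrability over `X` of a function with values in `ℤ⟦T₁, …, T_d⟧`: the level sets of nonzero
values are cylindric and only finitely many of them contribute to a given coefficient. -/
def IsMotivicIntegrable (k : Type u) [Field k] {d : ℕ} {K : Type u} [Field K] [Algebra k K]
    (X : Set (Projectivization K (BranchRing d K)))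
    (φ : Projectivization K (BranchRing d K) → MvPowerSeries (Fin d) ℤ) : Prop :=
  (∀ a, a ≠ 0 → IsCylindric k (X ∩ φ ⁻¹' {a})) ∧
  ∀ e : Fin d →₀ ℕ,
    {a | a ≠ 0 ∧ MvPowerSeries.coeff e a ≠ 0 ∧ (X ∩ φ ⁻¹' {a}).Nonempty}.Finite

/-- The integral `∫_X φ dχ_g = ∑_{a ≠ 0} χ_g(X ∩ φ⁻¹(a)) ⊗ a`, as a power series over `ℳ_k`. -/
noncomputable def motivicIntegral (k : Type u) [Field k] {d : ℕ} {K : Type u} [Field K]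
    [Algebra k K] (X : Set (Projectivization K (BranchRing d K)))
    (φ : Projectivization K (BranchRing d K) → MvPowerSeries (Fin d) ℤ) :
    MvPowerSeries (Fin d) (MotivicRing k) :=
  fun e => ∑ᶠ (a : MvPowerSeries (Fin d) ℤ) (_ : a ≠ 0),
    MvPowerSeries.coeff e a • genEulerChar k (X ∩ φ ⁻¹' {a})

open Classical in
/-- The function `T ^ v(z)` on `ℙ(K⟦t₁⟧ × ⋯ × K⟦t_d⟧)`; it is `0` where some `v_i(z)` is
infinite. -/
noncomputable def valMonomial {d : ℕ} {K : Type u} [Field K]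
    (x : Projectivization K (BranchRing d K)) : MvPowerSeries (Fin d) ℤ :=
  if ∀ i, x.rep i ≠ 0 then
    MvPowerSeries.monomial (Finsupp.equivFunOnFinite.symm fun i => (x.rep i).order.toNat) 1
  else 0

/-! ## The ring `𝒪`, its semigroup, its Poincaré series and the group `𝒥` -/

/-- A linear form with coefficients in `k` in finitely many of the coefficients `a_{j,i}` of an
element `(∑ a_{j,1} t₁ ^ j, …, ∑ a_{j,d} t_d ^ j)`. -/
noncomputable def evalForm {k : Type u} [Field k] {d : ℕ} {R : Type u} [CommRing R] [Algebra k R]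
    (l : Fin d × ℕ →₀ k) (z : BranchRing d R) : R :=
  l.sum fun p a => a • PowerSeries.coeff p.2 (z p.1)

/-- The points `𝒪_R` of `𝒪` with coefficients in a `k`-algebra `R`: the elements of
`R⟦t₁⟧ × ⋯ × R⟦t_d⟧` satisfying the linear equations over `k` that define `𝒪`. -/
def ringPoints {k : Type u} [Field k] {d : ℕ} (O : Subalgebra k (BranchRing d k))
    (R : Type u) [CommRing R] [Algebra k R] : Set (BranchRing d R) :=
  {z | ∀ l : Fin d × ℕ →₀ k, (∀ y ∈ O, evalForm l y = 0) → evalForm l z = 0}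

/-- The semigroup of values of `𝒪`. -/
def valueSemigroup {k : Type u} [Field k] {d : ℕ} (O : Subalgebra k (BranchRing d k)) :
    Set (Fin d → ℕ) :=
  {n | ∃ z ∈ O, ∀ i, (z i).order = n i}

/-- The singularity degree `δ = dim_k (𝒪̃ / 𝒪)`. -/
noncomputable def singularityDegree {k : Type u} [Field k] {d : ℕ}
    (O : Subalgebra k (BranchRing d k)) : ℕ :=
  Module.finrank k (BranchRing d k ⧸ Subalgebra.toSubmodule O)

/-- The points of `ℙ𝒪` with coordinates in `K`. -/
def projRing {k : Type u} [Field k] {d : ℕ} (O : Subalgebra k (BranchRing d k))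
    (K : Type u) [Field K] [Algebra k K] : Set (Projectivization K (BranchRing d K)) :=
  {x | x.rep ∈ ringPoints O K}

/-- The generalized Poincaré series `P_g(T₁, …, T_d, 𝒪) = ∫_{ℙ𝒪} T ^ v(z) dχ_g`. -/
noncomputable def genPoincareSeries {k : Type u} [Field k] {d : ℕ}
    (O : Subalgebra k (BranchRing d k)) (K : Type u) [Field K] [Algebra k K] :
    MvPowerSeries (Fin d) (MotivicRing k) :=
  motivicIntegral k (projRing O K) valMonomial

/-- The map `A⟦t₁⟧ × ⋯ × A⟦t_d⟧ → R⟦t₁⟧ × ⋯ × R⟦t_d⟧` induced on coefficients by `φ : A → R`. -/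
noncomputable def coeffMap {k : Type u} [Field k] (d : ℕ) {A R : Type u} [CommRing A] [CommRing R]
    [Algebra k A] [Algebra k R] (φ : A →ₐ[k] R) : BranchRing d A →+* BranchRing d R :=
  (PowerSeries.map (φ : A →+* R)).compLeft (Fin d)

/-- `Spec A` is the algebraic group `𝒥 = 𝒪̃ˣ / 𝒪ˣ`: there is a unit `w` of `A⟦t₁⟧ × ⋯ × A⟦t_d⟧`
such that `(A, w)` represents the functor `R ↦ (𝒪̃_R)ˣ / (𝒪_R)ˣ` on `k`-algebras. -/
def RepresentsJ {k : Type u} [Field k] {d : ℕ} (O : Subalgebra k (BranchRing d k))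
    (A : Type u) [CommRing A] [Algebra k A] : Prop :=
  ∃ w : (BranchRing d A)ˣ, ∀ (R : Type u) [CommRing R] [Algebra k R] (g : (BranchRing d R)ˣ),
    ∃! φ : A →ₐ[k] R, ∃ h : (BranchRing d R)ˣ,
      (h : BranchRing d R) ∈ ringPoints O R ∧ ((h⁻¹ : (BranchRing d R)ˣ) : BranchRing d R) ∈ ringPoints O R ∧
      g = Units.map (coeffMap d φ : BranchRing d A →* BranchRing d R) w * h

/-! ## Classes of affine varieties -/

/-! The points of ℙ𝒪 are sorted by their value n. If N ≥ n and N ≥ c, the stratum of value n is a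
cylinder over a locally closed set of projective N-jets. The linear equations of 𝒪 involve only
coefficients below the conductor, so they can be read on the N-jet. Normalizing the leading
coefficient on one fixed branch i₀ places the whole set in a single affine chart. Let χ(n) be its
measure.

If n_a ≥ c_a, multiplication by t_a identifies the normalized jets of value n with those of value n
+ e_a, since no equation of 𝒪 sees the coefficients that move. The second jet space has one more
coordinate, so χ(n + e_a) = 𝕃⁻¹ χ(n) (`genEulerChar_valueStratum_add_single`). Hence P_g is the sum
over n ≤ c of χ(n) T^n ∏_{n_i = c_i} (1 - 𝕃⁻¹ T_i)⁻¹, and Q is the sum over n ≤ c of χ(n) T^n ∏_{n_i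
< c_i} (1 - 𝕃⁻¹ T_i). The degree bound is visible. At T_i = 𝕃 only n = c survives
(`exists_mvPolynomial_of_step`). The c-jets of value c are tuples of nonzero leading coefficients up
to scaling, so Q(𝕃, …, 𝕃) = 𝕃^{-d} [𝔾_m^{d-1}].

For 𝒥, call pivots the lexicographically largest indices of the linear forms vanishing on 𝒪; there
are δ of them. The pivot monomials span a complement of 𝒪_R, and they still do after multiplication
by any unit, because the relevant matrix is triangular (`existsUnique_add_sum_mem_ringPoints`). So
each unit g has exactly one multiplier of the form (idempotent of branch i₀) + ∑ s_q t^q that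
carries it into 𝒪_R. The s_q are coordinates on 𝒥. As 𝒪 is local, the pivots of degree 0 are the (i,
0) with i ≠ i₀, and those s_q must be invertible while the others are free. Thus 𝒥 ≅ 𝔾_m^{d-1} ×
𝔸^{δ-d+1} (`representsJ_groupCondition`), and 𝕃^{-δ-1} [𝒥] is again 𝕃^{-d} [𝔾_m^{d-1}].

All of this needs χ_g to be independent of choices (`hasMotivicMeasure_unique`). By the
Nullstellensatz the class of a locally closed set depends only on its K-points, up to mutually
inverse rational maps over k. A common refinement compares two decompositions, and raising the jet
level multiplies classes by powers of 𝕃. -/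

namespace KVariety

variable {k : Type u} [Field k]

/-- The morphism of affine varieties induced by a homomorphism of algebras. -/
noncomputable def affineMap {A B : Type u} [CommRing A] [Algebra k A] [Algebra.FiniteType k A]
    [CommRing B] [Algebra k B] [Algebra.FiniteType k B] (φ : A →ₐ[k] B) :
    (affine k B).toOver ⟶ (affine k A).toOver :=
  Over.homMk (Spec.map (CommRingCat.ofHom φ.toRingHom)) (by
    dsimp [affine]
    rw [← Spec.map_comp, ← CommRingCat.ofHom_comp]
    congr 2
    exact φ.comp_algebraMap)

theorem affineMap_left {A B : Type u} [CommRing A] [Algebra k A] [Algebra.FiniteType k A]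
    [CommRing B] [Algebra k B] [Algebra.FiniteType k B] (φ : A →ₐ[k] B) :
    (affineMap φ).left = Spec.map (CommRingCat.ofHom φ.toRingHom) := rfl

theorem affineMap_comp {A B C : Type u} [CommRing A] [Algebra k A] [Algebra.FiniteType k A]
    [CommRing B] [Algebra k B] [Algebra.FiniteType k B]
    [CommRing C] [Algebra k C] [Algebra.FiniteType k C] (φ : A →ₐ[k] B) (ψ : B →ₐ[k] C) :
    affineMap ψ ≫ affineMap φ = affineMap (ψ.comp φ) := by
  ext1
  exact (Spec.map_comp (CommRingCat.ofHom φ.toRingHom) (CommRingCat.ofHom ψ.toRingHom)).symm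

theorem affineMap_id {A : Type u} [CommRing A] [Algebra k A] [Algebra.FiniteType k A] :
    affineMap (AlgHom.id k A) = 𝟙 (affine k A).toOver := by
  ext1
  rw [affineMap_left]
  exact Spec.map_id _

theorem sub_cls_eq_zero {x : FreeCommRing (KVariety k)} (h : GrothendieckRel k x) :
    (Ideal.Quotient.mk (Ideal.span {x | GrothendieckRel k x}) x) = 0 :=
  Ideal.Quotient.eq_zero_iff_mem.2 (Ideal.subset_span h)

theorem cls_affine_congr {A B : Type u} [CommRing A] [Algebra k A] [Algebra.FiniteType k A]
    [CommRing B] [Algebra k B] [Algebra.FiniteType k B] (e : A ≃ₐ[k] B) :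
    (affine k A).cls = (affine k B).cls := by
  have h := sub_cls_eq_zero (GrothendieckRel.iso (affine k A) (affine k B)
    ⟨affineMap e.symm.toAlgHom, affineMap e.toAlgHom, by
      rw [affineMap_comp, ← affineMap_id]; congr 1; ext x; simp, by
      rw [affineMap_comp, ← affineMap_id]; congr 1; ext x; simp⟩)
  rw [map_sub, sub_eq_zero] at h
  exact h

/-- The scissor relation for a principal open subset of an affine variety. -/
theorem cls_affine_eq_add {A U Z : Type u} [CommRing A] [Algebra k A] [Algebra.FiniteType k A]
    [CommRing U] [Algebra k U] [Algebra.FiniteType k U]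
    [CommRing Z] [Algebra k Z] [Algebra.FiniteType k Z] (f : A)
    [Algebra A U] [IsScalarTower k A U] [IsLocalization.Away f U] (π : A →ₐ[k] Z)
    (hπ : Function.Surjective π)
    (hker : PrimeSpectrum.zeroLocus (RingHom.ker π : Set A) = PrimeSpectrum.zeroLocus {f}) :
    (affine k A).cls = (affine k U).cls + (affine k Z).cls := by
  have h := sub_cls_eq_zero (GrothendieckRel.scissor (affine k A) (affine k U) (affine k Z)
    (affineMap (IsScalarTower.toAlgHom k A U)) (affineMap π)
    (IsOpenImmersion.of_isLocalization (S := U) f)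
    (IsClosedImmersion.spec_of_surjective _ hπ) ?_)
  · rw [map_sub, sub_eq_zero, map_add] at h
    exact h
  · have h1 : Set.range (Spec.map (CommRingCat.ofHom (algebraMap A U))) =
        (PrimeSpectrum.basicOpen f : Set (PrimeSpectrum A)) :=
      PrimeSpectrum.localization_away_comap_range U f
    have h2 : Set.range (Spec.map (CommRingCat.ofHom π.toRingHom)) =
        PrimeSpectrum.zeroLocus (RingHom.ker π : Set A) :=
      range_comap_of_surjective _ π.toRingHom hπ
    have h3 : Set.range (Spec.map (CommRingCat.ofHom (algebraMap A U))) =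
        (Set.range (Spec.map (CommRingCat.ofHom π.toRingHom)))ᶜ := by
      rw [h1, h2, hker, PrimeSpectrum.basicOpen_eq_zeroLocus_compl]
      rfl
    exact h3

/-- The empty scheme is both an open part and the complementary closed part of itself, so the
scissor relation reads [∅] = [∅] + [∅]. -/
theorem cls_affine_of_subsingleton (A : Type u) [CommRing A] [Algebra k A]
    [Algebra.FiniteType k A] [Subsingleton A] : (affine k A).cls = 0 := by
  have : IsLocalization.Away (0 : A) A :=
    IsLocalization.away_of_isUnit_of_bijective A (by
      rw [Subsingleton.elim (0 : A) 1]; exact isUnit_one) Function.bijective_id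
  have h := cls_affine_eq_add (k := k) (A := A) (U := A) (Z := A) 0 (AlgHom.id k A)
    Function.surjective_id (by
      have : IsEmpty (PrimeSpectrum A) := inferInstance
      exact Subsingleton.elim _ _)
  simpa using h

/-- The class of an affine variety is the class of its closed subvarieties with the same points. -/
theorem cls_affine_of_surjective {A Z : Type u} [CommRing A] [Algebra k A]
    [Algebra.FiniteType k A] [CommRing Z] [Algebra k Z] [Algebra.FiniteType k Z] (π : A →ₐ[k] Z)
    (hπ : Function.Surjective π) (hker : RingHom.ker π ≤ nilradical A) :
    (affine k A).cls = (affine k Z).cls := by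
  -- The scissor relation is used with f = 0: the open part D(0) is empty and contributes 0, and Z
  -- has all the points of Spec A.
  have : Subsingleton (Localization.Away (0 : A)) :=
    IsLocalization.subsingleton (M := Submonoid.powers (0 : A)) (Submonoid.mem_powers _)
  have : Algebra.FiniteType k (Localization.Away (0 : A)) :=
    have : Algebra.FiniteType A (Localization.Away (0 : A)) :=
      IsLocalization.finiteType_of_monoid_fg (Submonoid.powers (0 : A)) _
    Algebra.FiniteType.trans (S := A) inferInstance inferInstance
  have h := cls_affine_eq_add (k := k) (U := Localization.Away (0 : A)) 0 π hπ (by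
    rw [PrimeSpectrum.zeroLocus_singleton_zero, Set.eq_univ_iff_forall]
    intro x a ha
    exact nilpotent_iff_mem_prime.1 (mem_nilradical.1 (hker ha)) x.asIdeal x.isPrime)
  rw [h, cls_affine_of_subsingleton, zero_add]

open TensorProduct in
theorem cls_affine_tensorProduct {A B T : Type u} [CommRing A] [Algebra k A]
    [Algebra.FiniteType k A] [CommRing B] [Algebra k B] [Algebra.FiniteType k B]
    [CommRing T] [Algebra k T] [Algebra.FiniteType k T] (e : T ≃ₐ[k] A ⊗[k] B) :
    (affine k T).cls = (affine k A).cls * (affine k B).cls := by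
  have : Algebra.FiniteType k (A ⊗[k] B) := Algebra.FiniteType.equiv inferInstance e
  rw [cls_affine_congr e]
  have h := sub_cls_eq_zero (GrothendieckRel.prod (affine k A) (affine k B) (affine k (A ⊗[k] B))
    _ _ (isPullback_SpecMap_of_isPushout _ _ _ _ (CommRingCat.isPushout_tensorProduct k A B)) ?_)
  · rw [map_sub, sub_eq_zero, map_mul] at h
    exact h
  · dsimp only [affine, Over.mk_hom]
    rw [← Spec.map_comp, ← CommRingCat.ofHom_comp]

theorem cls_affine_self : (affine k k).cls = 1 := by
  have h := sub_cls_eq_zero (GrothendieckRel.point (k := k))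
  rw [map_sub, sub_eq_zero, map_one] at h
  exact h

open TensorProduct in
theorem cls_affine_mvPolynomial (ρ : Type) [Finite ρ] :
    (affine k (MvPolynomial ρ k)).cls = affineLineClass k ^ Nat.card ρ := by
  refine Finite.induction_empty_option (P := fun ρ => ∀ [Finite ρ],
    (affine k (MvPolynomial ρ k)).cls = affineLineClass k ^ Nat.card ρ) ?_ ?_ ?_ ρ
  · intro α β e h _
    have : Finite α := Finite.of_equiv β e.symm
    rw [← Nat.card_congr e, ← h]
    exact cls_affine_congr (MvPolynomial.renameEquiv k e.symm)
  · intro _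
    rw [Nat.card_of_isEmpty, pow_zero, ← cls_affine_self]
    exact cls_affine_congr (MvPolynomial.isEmptyAlgEquiv k PEmpty)
  · intro α _ h _
    rw [Finite.card_option, pow_succ, ← h]
    exact cls_affine_tensorProduct ((MvPolynomial.optionEquivLeft k α).trans
      ((polyEquivTensor k (MvPolynomial α k)).restrictScalars k))

end KVariety

/-! ## Points of finitely generated algebras -/

section Nullstellensatz

variable {k : Type u} [Field k] (K : Type u) [Field K] [IsAlgClosed K] [Algebra k K]
  {A : Type u} [CommRing A] [Algebra k A] [Algebra.FiniteType k A]

/-- By Zariski's lemma the residue field at a maximal ideal is finite over k, hence embeds in K,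
even if K is transcendental over k. -/
theorem nonempty_algHom_of_nontrivial [Nontrivial A] : Nonempty (A →ₐ[k] K) := by
  obtain ⟨m, hm⟩ := Ideal.exists_maximal A
  let _ := Ideal.Quotient.field m
  have : Module.Finite k (A ⧸ m) := finite_of_finite_type_of_isJacobsonRing k (A ⧸ m)
  exact ⟨(IsAlgClosed.lift (R := k) (S := A ⧸ m) (M := K)).comp (Ideal.Quotient.mkₐ k m)⟩

/-- Rabinowitsch's trick: if a is not nilpotent, the ring A_a is nonzero, and a K-point of it is a
K-point of A at which a does not vanish. -/
theorem isNilpotent_of_forall_algHom {a : A} (h : ∀ φ : A →ₐ[k] K, φ a = 0) : IsNilpotent a := by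
  by_contra hn
  have : Nontrivial (Localization.Away a) := by
    rw [← not_subsingleton_iff_nontrivial,
      IsLocalization.subsingleton_iff (M := Submonoid.powers a)]
    rintro ⟨n, hn'⟩
    exact hn ⟨n, hn'⟩
  have : Algebra.FiniteType A (Localization.Away a) :=
    IsLocalization.finiteType_of_monoid_fg (Submonoid.powers a) _
  have : Algebra.FiniteType k (Localization.Away a) :=
    Algebra.FiniteType.trans (S := A) inferInstance inferInstance
  obtain ⟨φ⟩ := nonempty_algHom_of_nontrivial (k := k) K (A := Localization.Away a)
  have h1 : IsUnit (φ (algebraMap A (Localization.Away a) a)) :=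
    (IsLocalization.Away.algebraMap_isUnit a).map φ
  exact h1.ne_zero (h (φ.comp (IsScalarTower.toAlgHom k A _)))

theorem isUnit_of_forall_algHom {a : A} (h : ∀ φ : A →ₐ[k] K, φ a ≠ 0) : IsUnit a := by
  by_contra hn
  have : Nontrivial (A ⧸ Ideal.span {a}) := by
    rw [Ideal.Quotient.nontrivial_iff, Ne, Ideal.span_singleton_eq_top]
    exact hn
  obtain ⟨φ⟩ := nonempty_algHom_of_nontrivial (k := k) K (A := A ⧸ Ideal.span {a})
  refine h (φ.comp (Ideal.Quotient.mkₐ k _)) ?_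
  have : Ideal.Quotient.mk (Ideal.span {a}) a = 0 :=
    Ideal.Quotient.eq_zero_iff_mem.2 (Ideal.mem_span_singleton_self a)
  simp [this]

theorem eq_of_forall_algHom [IsReduced A] {a b : A} (h : ∀ φ : A →ₐ[k] K, φ a = φ b) : a = b :=
  sub_eq_zero.1 (isNilpotent_of_forall_algHom (k := k) K fun φ => by
    rw [map_sub, h, sub_self]).eq_zero

end Nullstellensatz

namespace BasicCondition

variable {k : Type u} [Field k] {σ τ : Type}

/-- The reduced coordinate ring. -/
abbrev redRing (B : BasicCondition k σ) : Type u := B.coordRing ⧸ nilradical B.coordRing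

/-- The coordinate functions in the reduced coordinate ring. -/
noncomputable def gen (B : BasicCondition k σ) (s : σ) : B.redRing :=
  Ideal.Quotient.mk _ (algebraMap _ B.coordRing (Ideal.Quotient.mk B.I (MvPolynomial.X s)))

/-- The quotient map from the polynomial ring to the coordinate ring. -/
noncomputable def toCoordRing (B : BasicCondition k σ) : MvPolynomial σ k →ₐ[k] B.coordRing :=
  (IsScalarTower.toAlgHom k (MvPolynomial σ k ⧸ B.I) B.coordRing).comp (Ideal.Quotient.mkₐ k B.I)

theorem toCoordRing_apply (B : BasicCondition k σ) (p : MvPolynomial σ k) :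
    B.toCoordRing p = algebraMap _ B.coordRing (Ideal.Quotient.mk B.I p) := rfl

theorem toCoordRing_eq_zero (B : BasicCondition k σ) {p : MvPolynomial σ k} (hp : p ∈ B.I) :
    B.toCoordRing p = 0 := by
  rw [toCoordRing_apply, Ideal.Quotient.eq_zero_iff_mem.2 hp, map_zero]

theorem isUnit_toCoordRing (B : BasicCondition k σ) : IsUnit (B.toCoordRing B.q) :=
  IsLocalization.Away.algebraMap_isUnit (S := B.coordRing) (Ideal.Quotient.mk B.I B.q)

theorem coordRing_algHom_ext (B : BasicCondition k σ) {T : Type*} [CommRing T] [Algebra k T]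
    {φ ψ : B.coordRing →ₐ[k] T}
    (h : ∀ s, φ (B.toCoordRing (MvPolynomial.X s)) = ψ (B.toCoordRing (MvPolynomial.X s))) :
    φ = ψ := by
  refine IsLocalization.algHom_ext (Submonoid.powers (Ideal.Quotient.mk B.I B.q)) ?_
  refine Ideal.Quotient.algHom_ext _ ?_
  exact MvPolynomial.algHom_ext h

theorem exists_coordRing_lift (B : BasicCondition k σ) {T : Type*} [CommRing T] [Algebra k T]
    (y : σ → T) (hI : ∀ p ∈ B.I, MvPolynomial.aeval y p = 0)
    (hq : IsUnit (MvPolynomial.aeval y B.q)) :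
    ∃ φ : B.coordRing →ₐ[k] T, ∀ p, φ (B.toCoordRing p) = MvPolynomial.aeval y p := by
  refine ⟨IsLocalization.liftAlgHom (M := Submonoid.powers (Ideal.Quotient.mk B.I B.q))
    (f := Ideal.Quotient.liftₐ B.I (MvPolynomial.aeval y) hI) ?_, fun p => ?_⟩
  · rintro ⟨_, n, rfl⟩
    rw [map_pow]
    exact hq.pow n
  · exact IsLocalization.lift_eq _ _

theorem aeval_gen (B : BasicCondition k σ) (p : MvPolynomial σ k) :
    MvPolynomial.aeval B.gen p = Ideal.Quotient.mk _ (B.toCoordRing p) := by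
  have : MvPolynomial.aeval B.gen =
      (Ideal.Quotient.mkₐ k (nilradical B.coordRing)).comp B.toCoordRing := by
    refine MvPolynomial.algHom_ext fun s => ?_
    rw [MvPolynomial.aeval_X]
    rfl
  rw [this]
  rfl

instance isReduced_redRing (B : BasicCondition k σ) : IsReduced B.redRing :=
  (Ideal.isRadical_iff_quotient_reduced _).1 (Ideal.radical_isRadical _)

instance finiteType_redRing [Finite σ] (B : BasicCondition k σ) :
    Algebra.FiniteType k B.redRing :=
  have := B.finiteType_coordRing
  Algebra.FiniteType.of_surjective (Ideal.Quotient.mkₐ k (nilradical B.coordRing))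
    Ideal.Quotient.mk_surjective

theorem cls_eq_redRing [Finite σ] (B : BasicCondition k σ) :
    B.cls = (KVariety.affine k B.redRing).cls := by
  have := B.finiteType_coordRing
  refine KVariety.cls_affine_of_surjective (Ideal.Quotient.mkₐ k (nilradical B.coordRing))
    Ideal.Quotient.mk_surjective ?_
  intro a ha
  exact Ideal.Quotient.eq_zero_iff_mem.1 ha

theorem redRing_algHom_ext (B : BasicCondition k σ) {T : Type*} [CommRing T] [Algebra k T]
    {φ ψ : B.redRing →ₐ[k] T} (h : ∀ s, φ (B.gen s) = ψ (B.gen s)) : φ = ψ :=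
  Ideal.Quotient.algHom_ext _ (B.coordRing_algHom_ext h)

theorem exists_redRing_lift (B : BasicCondition k σ) {T : Type*} [CommRing T] [Algebra k T]
    [IsReduced T] (y : σ → T) (hI : ∀ p ∈ B.I, MvPolynomial.aeval y p = 0)
    (hq : IsUnit (MvPolynomial.aeval y B.q)) :
    ∃ φ : B.redRing →ₐ[k] T, ∀ s, φ (B.gen s) = y s := by
  obtain ⟨φ, hφ⟩ := B.exists_coordRing_lift y hI hq
  refine ⟨Ideal.Quotient.liftₐ _ φ fun a ha => ((mem_nilradical.1 ha).map φ).eq_zero, fun s => ?_⟩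
  have := hφ (MvPolynomial.X s)
  rw [MvPolynomial.aeval_X] at this
  exact this

/-! ### Classes are determined by points over an algebraically closed field -/

section Points

variable (K : Type u) [Field K] [Algebra k K]

theorem map_aeval {T : Type*} [CommRing T] [Algebra k T] (φ : T →ₐ[k] K) (y : σ → T)
    (p : MvPolynomial σ k) :
    φ (MvPolynomial.aeval y p) = MvPolynomial.aeval (fun s => φ (y s)) p := by
  rw [← MvPolynomial.comp_aeval_apply]

theorem mem_points_of_algHom (B : BasicCondition k σ) (φ : B.redRing →ₐ[k] K) :
    (fun s => φ (B.gen s)) ∈ B.points K := by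
  refine ⟨fun p hp => ?_, ?_⟩
  · rw [← map_aeval, aeval_gen, toCoordRing_eq_zero _ hp, map_zero, map_zero]
  · rw [← map_aeval, aeval_gen]
    exact ((B.isUnit_toCoordRing.map (Ideal.Quotient.mk _)).map φ).ne_zero

/-- The point with coordinates `f u / g`. -/
noncomputable def ratEval {K : Type u} [Field K] [Algebra k K] (f : τ → MvPolynomial σ k)
    (g : MvPolynomial σ k) (x : σ → K) : τ → K :=
  fun t => MvPolynomial.aeval x (f t) / MvPolynomial.aeval x g

variable [IsAlgClosed K]

/-- A denominator without zeros on the K-points of B is a unit in the coordinate ring, and the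
equations of C hold in the reduced ring of B because they hold at every K-point. So a rational map
on points comes from a ring homomorphism. -/
theorem exists_redRing_algHom [Finite σ] (B : BasicCondition k σ) (C : BasicCondition k τ)
    (f : τ → MvPolynomial σ k) (g : MvPolynomial σ k)
    (h : ∀ x ∈ B.points K, MvPolynomial.aeval x g ≠ 0 ∧ ratEval f g x ∈ C.points K) :
    ∃ Φ : C.redRing →ₐ[k] B.redRing, ∀ φ : B.redRing →ₐ[k] K, ∀ t,
      φ (Φ (C.gen t)) = ratEval f g (fun s => φ (B.gen s)) t := by
  have hg : IsUnit (MvPolynomial.aeval B.gen g) := by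
    refine isUnit_of_forall_algHom (k := k) K fun φ => ?_
    rw [map_aeval]
    exact (h _ (B.mem_points_of_algHom K φ)).1
  obtain ⟨v, hv⟩ := hg.exists_right_inv
  have key : ∀ φ : B.redRing →ₐ[k] K, (fun t => φ (MvPolynomial.aeval B.gen (f t) * v)) =
      ratEval f g fun s => φ (B.gen s) := by
    intro φ
    ext t
    have h1 := (h _ (B.mem_points_of_algHom K φ)).1
    have h2 := congrArg φ hv
    rw [map_mul, map_one, map_aeval] at h2
    rw [ratEval, map_mul, map_aeval, eq_div_iff h1, mul_assoc, mul_comm (φ v), h2, mul_one]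
  obtain ⟨Φ, hΦ⟩ := C.exists_redRing_lift (fun t => MvPolynomial.aeval B.gen (f t) * v) (by
      intro p hp
      refine eq_of_forall_algHom (k := k) K fun φ => ?_
      rw [map_aeval, key, map_zero]
      exact (h _ (B.mem_points_of_algHom K φ)).2.1 p hp) (by
      refine isUnit_of_forall_algHom (k := k) K fun φ => ?_
      rw [map_aeval, key]
      exact (h _ (B.mem_points_of_algHom K φ)).2.2)
  exact ⟨Φ, fun φ t => by rw [hΦ]; exact congrFun (key φ) t⟩

/-- Mutually inverse rational maps with coefficients in `k` give equality of classes. -/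
theorem cls_eq_of_ratEval [Finite σ] [Finite τ] (B : BasicCondition k σ) (C : BasicCondition k τ)
    (f : τ → MvPolynomial σ k) (g : MvPolynomial σ k)
    (f' : σ → MvPolynomial τ k) (g' : MvPolynomial τ k)
    (h : ∀ x ∈ B.points K, MvPolynomial.aeval x g ≠ 0 ∧ ratEval f g x ∈ C.points K ∧
      ratEval f' g' (ratEval f g x) = x)
    (h' : ∀ y ∈ C.points K, MvPolynomial.aeval y g' ≠ 0 ∧ ratEval f' g' y ∈ B.points K ∧
      ratEval f g (ratEval f' g' y) = y) :
    B.cls = C.cls := by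
  obtain ⟨Φ, hΦ⟩ := exists_redRing_algHom K B C f g fun x hx => ⟨(h x hx).1, (h x hx).2.1⟩
  obtain ⟨Ψ, hΨ⟩ := exists_redRing_algHom K C B f' g' fun x hx => ⟨(h' x hx).1, (h' x hx).2.1⟩
  rw [cls_eq_redRing, cls_eq_redRing]
  -- Reduced rings are separated by their K-points, so it is enough that the maps are inverse to
  -- each other on points.
  refine KVariety.cls_affine_congr (AlgEquiv.ofAlgHom Ψ Φ ?_ ?_)
  · refine C.redRing_algHom_ext fun t => eq_of_forall_algHom (k := k) K fun φ => ?_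
    have h1 := hΦ (φ.comp Ψ) t
    have h2 : (fun s => (φ.comp Ψ) (B.gen s)) = ratEval f' g' fun t => φ (C.gen t) :=
      funext fun s => hΨ φ s
    rw [h2, (h' _ (C.mem_points_of_algHom K φ)).2.2] at h1
    exact h1
  · refine B.redRing_algHom_ext fun s => eq_of_forall_algHom (k := k) K fun φ => ?_
    have h1 := hΨ (φ.comp Φ) s
    have h2 : (fun t => (φ.comp Φ) (C.gen t)) = ratEval f g fun s => φ (B.gen s) :=
      funext fun t => hΦ φ t
    rw [h2, (h _ (B.mem_points_of_algHom K φ)).2.2] at h1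
    exact h1

/-- Mutually inverse polynomial maps with coefficients in `k` give equality of classes. -/
theorem cls_eq_of_polyEval [Finite σ] [Finite τ] (B : BasicCondition k σ) (C : BasicCondition k τ)
    (f : τ → MvPolynomial σ k) (f' : σ → MvPolynomial τ k)
    (h : ∀ x ∈ B.points K, (fun t => MvPolynomial.aeval x (f t)) ∈ C.points K ∧
      ∀ s, MvPolynomial.aeval (fun t => MvPolynomial.aeval x (f t)) (f' s) = x s)
    (h' : ∀ y ∈ C.points K, (fun s => MvPolynomial.aeval y (f' s)) ∈ B.points K ∧
      ∀ t, MvPolynomial.aeval (fun s => MvPolynomial.aeval y (f' s)) (f t) = y t) :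
    B.cls = C.cls := by
  refine cls_eq_of_ratEval K B C f 1 f' 1 (fun x hx => ?_) fun y hy => ?_
  · have : ratEval f 1 x = fun t => MvPolynomial.aeval x (f t) := by
      ext t; simp [ratEval]
    rw [this]
    exact ⟨by simp, (h x hx).1, funext fun s => by simpa [ratEval] using (h x hx).2 s⟩
  · have : ratEval f' 1 y = fun s => MvPolynomial.aeval y (f' s) := by
      ext t; simp [ratEval]
    rw [this]
    exact ⟨by simp, (h' y hy).1, funext fun s => by simpa [ratEval] using (h' y hy).2 s⟩

theorem cls_eq_of_points_eq [Finite σ] (B C : BasicCondition k σ)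
    (h : B.points K = C.points K) : B.cls = C.cls := by
  refine cls_eq_of_polyEval K B C MvPolynomial.X MvPolynomial.X (fun x hx => ?_) fun x hx => ?_
  · simpa [← h] using hx
  · simpa [h] using hx

theorem cls_eq_zero_of_points_eq_empty [Finite σ] (B : BasicCondition k σ)
    (h : B.points K = ∅) : B.cls = 0 := by
  rw [cls_eq_redRing]
  have : Subsingleton B.redRing := by
    by_contra hn
    rw [not_subsingleton_iff_nontrivial] at hn
    obtain ⟨φ⟩ := nonempty_algHom_of_nontrivial (k := k) K (A := B.redRing)
    have := B.mem_points_of_algHom K φ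
    rw [h] at this
    exact this
  exact KVariety.cls_affine_of_subsingleton _

end Points

end BasicCondition

/-! ## Additivity of classes on constructible sets -/

namespace BasicCondition

variable {k : Type u} [Field k] {σ τ : Type}

/-- The condition `B` together with `f ≠ 0`. -/
noncomputable def restrictNe (B : BasicCondition k σ) (f : MvPolynomial σ k) :
    BasicCondition k σ := ⟨B.I, B.q * f⟩

/-- The condition `B` together with `f = 0`. -/
noncomputable def restrictEq (B : BasicCondition k σ) (f : MvPolynomial σ k) :
    BasicCondition k σ := ⟨B.I ⊔ Ideal.span {f}, B.q⟩

/-- The conjunction of two conditions. -/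
noncomputable def inter (B C : BasicCondition k σ) : BasicCondition k σ := ⟨B.I ⊔ C.I, B.q * C.q⟩

/-- The condition satisfied by all points. -/
noncomputable def univ : BasicCondition k σ := ⟨⊥, 1⟩

theorem forall_mem_sup_aeval {K : Type u} [Field K] [Algebra k K] (I J : Ideal (MvPolynomial σ k))
    (x : σ → K) : (∀ p ∈ I ⊔ J, MvPolynomial.aeval x p = 0) ↔
      (∀ p ∈ I, MvPolynomial.aeval x p = 0) ∧ ∀ p ∈ J, MvPolynomial.aeval x p = 0 :=
  sup_le_iff (a := I) (b := J) (c := RingHom.ker (MvPolynomial.aeval (R := k) x))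

theorem forall_mem_span_aeval {K : Type u} [Field K] [Algebra k K] (S : Set (MvPolynomial σ k))
    (x : σ → K) : (∀ p ∈ Ideal.span S, MvPolynomial.aeval x p = 0) ↔
      ∀ p ∈ S, MvPolynomial.aeval x p = 0 :=
  Ideal.span_le (s := S) (I := RingHom.ker (MvPolynomial.aeval (R := k) x))

theorem mem_points_inter {K : Type u} [Field K] [Algebra k K] (B C : BasicCondition k σ)
    (x : σ → K) : x ∈ (B.inter C).points K ↔ x ∈ B.points K ∧ x ∈ C.points K := by
  simp only [inter, points, Set.mem_ofPred_eq, forall_mem_sup_aeval, map_mul, mul_ne_zero_iff]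
  tauto

/-- This is the scissor relation for f on the coordinate ring of B. The work lies in identifying
iterated localizations and quotients with the one-step presentations of the two pieces. -/
theorem cls_eq_restrictNe_add_restrictEq [Finite σ] (B : BasicCondition k σ)
    (f : MvPolynomial σ k) : B.cls = (B.restrictNe f).cls + (B.restrictEq f).cls := by
  have := B.finiteType_coordRing
  have := (B.restrictNe f).finiteType_coordRing
  have := (B.restrictEq f).finiteType_coordRing
  have : Algebra.FiniteType B.coordRing (Localization.Away (B.toCoordRing f)) :=
    IsLocalization.finiteType_of_monoid_fg (Submonoid.powers (B.toCoordRing f)) _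
  have : Algebra.FiniteType k (Localization.Away (B.toCoordRing f)) :=
    Algebra.FiniteType.trans (S := B.coordRing) inferInstance inferInstance
  have : Algebra.FiniteType k (B.coordRing ⧸ Ideal.span {B.toCoordRing f}) :=
    Algebra.FiniteType.of_surjective (Ideal.Quotient.mkₐ k _) Ideal.Quotient.mk_surjective
  have h := KVariety.cls_affine_eq_add (k := k) (U := Localization.Away (B.toCoordRing f))
    (B.toCoordRing f) (Ideal.Quotient.mkₐ k (Ideal.span {B.toCoordRing f}))
    Ideal.Quotient.mk_surjective (by
      rw [← PrimeSpectrum.zeroLocus_span {B.toCoordRing f}]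
      congr 1
      ext a
      exact Ideal.Quotient.eq_zero_iff_mem (I := Ideal.span {B.toCoordRing f}))
  have hX : ∀ (C : BasicCondition k σ) (p : MvPolynomial σ k),
      MvPolynomial.aeval (fun s => C.toCoordRing (MvPolynomial.X s)) p = C.toCoordRing p := by
    intro C p
    rw [← MvPolynomial.comp_aeval_apply, MvPolynomial.aeval_X_left, AlgHom.id_apply]
  have hU : (KVariety.affine k (Localization.Away (B.toCoordRing f))).cls =
      (B.restrictNe f).cls := by
    have hu := (B.restrictNe f).isUnit_toCoordRing
    change IsUnit ((B.restrictNe f).toCoordRing (B.q * f)) at hu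
    rw [map_mul, IsUnit.mul_iff] at hu
    obtain ⟨φ, hφ⟩ := B.exists_coordRing_lift
      (fun s => (B.restrictNe f).toCoordRing (MvPolynomial.X s))
      (fun p hp => by rw [hX]; exact toCoordRing_eq_zero _ hp) (by rw [hX]; exact hu.1)
    let ι : B.coordRing →ₐ[k] Localization.Away (B.toCoordRing f) :=
      IsScalarTower.toAlgHom k _ _
    have hι : ∀ p, MvPolynomial.aeval (fun s => ι (B.toCoordRing (MvPolynomial.X s))) p =
        ι (B.toCoordRing p) := by
      intro p
      rw [← MvPolynomial.comp_aeval_apply, hX]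
    obtain ⟨ψ, hψ⟩ := (B.restrictNe f).exists_coordRing_lift
      (fun s => ι (B.toCoordRing (MvPolynomial.X s)))
      (fun p hp => by rw [hι, B.toCoordRing_eq_zero hp, map_zero]) (by
        rw [hι]
        change IsUnit (ι (B.toCoordRing (B.q * f)))
        rw [map_mul, map_mul]
        exact (B.isUnit_toCoordRing.map ι).mul (IsLocalization.Away.algebraMap_isUnit _))
    let Φ : Localization.Away (B.toCoordRing f) →ₐ[k] (B.restrictNe f).coordRing :=
      IsLocalization.liftAlgHom (M := Submonoid.powers (B.toCoordRing f)) (f := φ) (by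
        rintro ⟨_, n, rfl⟩
        change IsUnit (φ (B.toCoordRing f ^ n))
        rw [map_pow, hφ, hX]
        exact hu.2.pow n)
    have hΦ : ∀ a, Φ (ι a) = φ a := fun a => IsLocalization.lift_eq _ _
    refine KVariety.cls_affine_congr (AlgEquiv.ofAlgHom Φ ψ ?_ ?_)
    · refine coordRing_algHom_ext _ fun s => ?_
      rw [AlgHom.comp_apply, hψ, MvPolynomial.aeval_X, hΦ, hφ, MvPolynomial.aeval_X,
        AlgHom.id_apply]
    · refine IsLocalization.algHom_ext (Submonoid.powers (B.toCoordRing f)) ?_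
      refine coordRing_algHom_ext _ fun s => ?_
      change ψ (Φ (ι _)) = ι _
      rw [hΦ, hφ, MvPolynomial.aeval_X, hψ, MvPolynomial.aeval_X]
  have hZ : (KVariety.affine k (B.coordRing ⧸ Ideal.span {B.toCoordRing f})).cls =
      (B.restrictEq f).cls := by
    obtain ⟨φ, hφ⟩ := B.exists_coordRing_lift
      (fun s => (B.restrictEq f).toCoordRing (MvPolynomial.X s))
      (fun p hp => by rw [hX]; exact toCoordRing_eq_zero _ (Ideal.mem_sup_left hp))
      (by rw [hX]; exact (B.restrictEq f).isUnit_toCoordRing)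
    let ι : B.coordRing →ₐ[k] B.coordRing ⧸ Ideal.span {B.toCoordRing f} :=
      Ideal.Quotient.mkₐ k _
    have hι : ∀ p, MvPolynomial.aeval (fun s => ι (B.toCoordRing (MvPolynomial.X s))) p =
        ι (B.toCoordRing p) := by
      intro p
      rw [← MvPolynomial.comp_aeval_apply, hX]
    have hker : B.I ⊔ Ideal.span {f} ≤ RingHom.ker (ι.comp B.toCoordRing) := by
      refine sup_le (fun p hp => ?_) (Ideal.span_le.2 ?_)
      · rw [RingHom.mem_ker, AlgHom.comp_apply, toCoordRing_eq_zero _ hp, map_zero]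
      · rintro _ rfl
        exact Ideal.Quotient.eq_zero_iff_mem.2 (Ideal.mem_span_singleton_self _)
    obtain ⟨ψ, hψ⟩ := (B.restrictEq f).exists_coordRing_lift
      (fun s => ι (B.toCoordRing (MvPolynomial.X s)))
      (fun p hp => by rw [hι]; exact hker hp) (by
        rw [hι]
        exact B.isUnit_toCoordRing.map ι)
    have hle : ∀ a ∈ Ideal.span {B.toCoordRing f}, φ a = 0 := by
      change Ideal.span {B.toCoordRing f} ≤ RingHom.ker φ
      rw [Ideal.span_le]
      rintro _ rfl
      change φ _ = 0
      rw [hφ, hX]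
      exact toCoordRing_eq_zero _ (Ideal.mem_sup_right (Ideal.mem_span_singleton_self f))
    refine KVariety.cls_affine_congr
      (AlgEquiv.ofAlgHom (Ideal.Quotient.liftₐ _ φ hle) ψ ?_ ?_)
    · refine coordRing_algHom_ext _ fun s => ?_
      rw [AlgHom.comp_apply, hψ, MvPolynomial.aeval_X]
      change φ _ = _
      rw [hφ, MvPolynomial.aeval_X, AlgHom.id_apply]
    · refine Ideal.Quotient.algHom_ext _ (coordRing_algHom_ext _ fun s => ?_)
      change ψ (φ _) = ι _
      rw [hφ, MvPolynomial.aeval_X, hψ, MvPolynomial.aeval_X]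
  rw [cls, h, hU, hZ]

/-- A property that can be checked on `B ∩ {f ≠ 0}` and `B ∩ {f = 0}` need only be checked for
conditions that decide the vanishing of finitely many given polynomials. -/
theorem induction_of_decides {E : BasicCondition k σ → Prop}
    (hE : ∀ B f, E (B.restrictNe f) → E (B.restrictEq f) → E B) (l : List (MvPolynomial σ k))
    (hl : ∀ B : BasicCondition k σ, (∀ f ∈ l, f ∈ B.I ∨ f ∣ B.q) → E B) (B) : E B := by
  induction l with
  | nil => exact hl B (by simp)
  | cons f l ih =>
    refine ih fun B hB => hE B f (hl _ ?_) (hl _ ?_)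
    · intro g hg
      rcases List.mem_cons.1 hg with rfl | hg
      · exact Or.inr (Dvd.intro_left _ rfl)
      · exact (hB g hg).imp id fun h => Dvd.dvd.mul_right h _
    · intro g hg
      rcases List.mem_cons.1 hg with rfl | hg
      · exact Or.inl (Ideal.mem_sup_right (Ideal.mem_span_singleton_self g))
      · exact (hB g hg).imp (fun h => Ideal.mem_sup_left h) id

theorem mem_points_restrictNe {K : Type u} [Field K] [Algebra k K] (B : BasicCondition k σ)
    (f : MvPolynomial σ k) (x : σ → K) :
    x ∈ (B.restrictNe f).points K ↔ x ∈ B.points K ∧ MvPolynomial.aeval x f ≠ 0 := by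
  simp only [restrictNe, points, Set.mem_ofPred_eq, map_mul, mul_ne_zero_iff]
  tauto

theorem mem_points_restrictEq {K : Type u} [Field K] [Algebra k K] (B : BasicCondition k σ)
    (f : MvPolynomial σ k) (x : σ → K) :
    x ∈ (B.restrictEq f).points K ↔ x ∈ B.points K ∧ MvPolynomial.aeval x f = 0 := by
  simp only [restrictEq, points, Set.mem_ofPred_eq, forall_mem_sup_aeval, forall_mem_span_aeval,
    Set.mem_singleton_iff, forall_eq]
  tauto

variable (K : Type u) [Field K] [Algebra k K]

theorem cls_inter_eq_restrict_add [Finite σ] (B C : BasicCondition k σ) (f : MvPolynomial σ k) :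
    (B.inter C).cls = ((B.restrictNe f).inter C).cls + ((B.restrictEq f).inter C).cls := by
  -- Classes do not refer to points, so any algebraically closed extension serves for the
  -- comparison.
  let K := AlgebraicClosure k
  rw [cls_eq_restrictNe_add_restrictEq _ f]
  congr 1
  · refine cls_eq_of_points_eq K _ _ (Set.ext fun x => ?_)
    simp only [mem_points_restrictNe, mem_points_inter]
    tauto
  · refine cls_eq_of_points_eq K _ _ (Set.ext fun x => ?_)
    simp only [mem_points_restrictEq, mem_points_inter]
    tauto

/-- Finitely many polynomials such that a condition that decides them decides `C`. -/
theorem exists_list_decides [Finite σ] (C : BasicCondition k σ) :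
    ∃ l : List (MvPolynomial σ k), ∀ B : BasicCondition k σ, (∀ f ∈ l, f ∈ B.I ∨ f ∣ B.q) →
      B.points K ⊆ C.points K ∨ Disjoint (B.points K) (C.points K) := by
  obtain ⟨S, hS⟩ : C.I.FG := IsNoetherian.noetherian C.I
  refine ⟨C.q :: S.toList, fun B hB => ?_⟩
  have hdvd : ∀ f, f ∣ B.q → ∀ x ∈ B.points K, MvPolynomial.aeval x f ≠ 0 := by
    rintro f ⟨g, hg⟩ x hx h0
    exact hx.2 (by rw [hg, map_mul, h0, zero_mul])
  have hCS : C.I = Ideal.span S := hS.symm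
  -- Either every deciding polynomial goes the way C requires, and then B lies in C, or one goes the
  -- opposite way at all points of B, and then B misses C.
  by_cases h : (∀ f ∈ S, f ∈ B.I) ∧ C.q ∣ B.q
  · refine Or.inl fun x hx => ⟨?_, hdvd _ h.2 x hx⟩
    rw [hCS, forall_mem_span_aeval]
    exact fun f hf => hx.1 f (h.1 f hf)
  · refine Or.inr (Set.disjoint_left.2 fun x hx hC => h ⟨fun f hf => ?_, ?_⟩)
    · refine (hB f (by simp [hf])).resolve_right fun h0 => hdvd f h0 x hx (hC.1 f ?_)
      rw [hCS]
      exact Ideal.subset_span hf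
    · exact (hB C.q (by simp)).resolve_left fun h0 => hC.2 (hx.1 _ h0)

/-- The class of a disjoint union is the sum of the classes. -/
theorem cls_eq_sum_of_points_eq_iUnion [IsAlgClosed K] [Finite σ] {ι : Type*} [Fintype ι]
    (A : BasicCondition k σ) (C : ι → BasicCondition k σ) (hU : A.points K = ⋃ i, (C i).points K)
    (hd : Pairwise fun i j => Disjoint ((C i).points K) ((C j).points K)) :
    A.cls = ∑ i, (C i).cls := by
  classical
  have huniv : ∀ C : BasicCondition k σ, (univ.inter C).cls = C.cls := fun C =>
    cls_eq_of_points_eq K _ _ (Set.ext fun x => by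
      rw [mem_points_inter, and_iff_right]
      simp [univ, points])
  -- Intersecting with an auxiliary B makes the identity additive in B, so B may be cut until A and
  -- every C i either contains it or misses it.
  suffices h : ∀ B : BasicCondition k σ, (B.inter A).cls = ∑ i, (B.inter (C i)).cls by
    simpa only [huniv] using h univ
  choose l hl using fun C : BasicCondition k σ => exists_list_decides K C
  refine induction_of_decides (fun B f h1 h2 => ?_) (l A ++ Finset.univ.toList.flatMap
    fun i => l (C i)) fun B hB => ?_
  · rw [cls_inter_eq_restrict_add B A f, h1, h2, ← Finset.sum_add_distrib]
    exact Finset.sum_congr rfl fun i _ => (cls_inter_eq_restrict_add B (C i) f).symm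
  have hA := hl A B fun f hf => hB f (by simp [hf])
  have hC := fun i => hl (C i) B fun f hf => hB f (by
    simp only [List.mem_append, List.mem_flatMap]
    exact Or.inr ⟨i, by simp, hf⟩)
  have hsub : ∀ D : BasicCondition k σ, B.points K ⊆ D.points K → (B.inter D).cls = B.cls :=
    fun D hD => cls_eq_of_points_eq K _ _ (Set.ext fun x => by
      rw [mem_points_inter]
      exact and_iff_left_of_imp fun hx => hD hx)
  have hdis : ∀ D : BasicCondition k σ, Disjoint (B.points K) (D.points K) →
      (B.inter D).cls = 0 := fun D hD =>
    cls_eq_zero_of_points_eq_empty K _ (Set.eq_empty_of_forall_notMem fun x hx => by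
      rw [mem_points_inter] at hx
      exact Set.disjoint_left.1 hD hx.1 hx.2)
  -- If the nonempty B lies in A, disjointness leaves exactly one C i containing it, and both sides
  -- are the class of B. Otherwise B misses A and every C i, and both sides vanish.
  rcases Set.eq_empty_or_nonempty (B.points K) with h0 | ⟨x, hx⟩
  · rw [hdis A (by simp [h0]), Finset.sum_eq_zero fun i _ => hdis (C i) (by simp [h0])]
  rcases hA with hA | hA
  · obtain ⟨i, hi⟩ := Set.mem_iUnion.1 (hU ▸ hA hx)
    have hi' := (hC i).resolve_right fun h => Set.disjoint_left.1 h hx hi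
    rw [hsub A hA, Finset.sum_eq_single i, hsub _ hi']
    · intro j _ hj
      exact hdis _ ((hd hj.symm).mono_left hi')
    · simp
  · rw [hdis A hA, Finset.sum_eq_zero fun i _ => ?_]
    refine hdis _ (hA.mono_right ?_)
    rw [hU]
    exact Set.subset_iUnion (fun i => (C i).points K) i

end BasicCondition

/-! ## Cones over constructible subsets of projective space -/

namespace BasicCondition

variable {k : Type u} [Field k] {σ τ : Type}

/-! ### Products with affine spaces -/

section Rename

open TensorProduct

/-- The condition on `τ` pulled back along the projection given by `e : σ → τ`. -/
noncomputable def rename (B : BasicCondition k σ) (e : σ → τ) : BasicCondition k τ :=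
  ⟨B.I.map (MvPolynomial.rename e : MvPolynomial σ k →ₐ[k] MvPolynomial τ k),
    MvPolynomial.rename e B.q⟩

theorem mem_points_rename {K : Type u} [Field K] [Algebra k K] (B : BasicCondition k σ)
    (e : σ → τ) (y : τ → K) : y ∈ (B.rename e).points K ↔ y ∘ e ∈ B.points K := by
  simp only [rename, points, Set.mem_ofPred_eq, MvPolynomial.aeval_rename, Ideal.map,
    forall_mem_span_aeval, Set.forall_mem_image]
  rfl

/-- Pulling back along a coordinate projection forms the product with the affine space of the new
coordinates ρ; its coordinate ring is the tensor product with a polynomial ring. -/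
theorem cls_rename_sum [Finite σ] [Finite τ] (B : BasicCondition k σ) {ρ : Type} [Finite ρ]
    (w : σ ⊕ ρ ≃ τ) : (B.rename (w ∘ Sum.inl)).cls = B.cls * affineLineClass k ^ Nat.card ρ := by
  have := B.finiteType_coordRing
  let R := B.rename (w ∘ Sum.inl)
  have := R.finiteType_coordRing
  have hX : ∀ p : MvPolynomial σ k,
      MvPolynomial.aeval (fun s => B.toCoordRing (MvPolynomial.X s)) p = B.toCoordRing p := by
    intro p
    rw [← MvPolynomial.comp_aeval_apply, MvPolynomial.aeval_X_left, AlgHom.id_apply]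
  let y : σ ⊕ ρ → B.coordRing ⊗[k] MvPolynomial ρ k :=
    Sum.elim (fun s => B.toCoordRing (MvPolynomial.X s) ⊗ₜ 1) fun r => 1 ⊗ₜ MvPolynomial.X r
  have hy : ∀ p : MvPolynomial σ k, MvPolynomial.aeval (y ∘ w.symm)
      (MvPolynomial.rename (w ∘ Sum.inl) p) = B.toCoordRing p ⊗ₜ 1 := by
    intro p
    rw [MvPolynomial.aeval_rename]
    have : (y ∘ w.symm) ∘ w ∘ Sum.inl = fun s =>
        (Algebra.TensorProduct.includeLeft : B.coordRing →ₐ[k] B.coordRing ⊗[k] MvPolynomial ρ k)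
          (B.toCoordRing (MvPolynomial.X s)) := by
      ext s; simp [y]
    rw [this, ← MvPolynomial.comp_aeval_apply, hX]
    rfl
  obtain ⟨φ, hφ⟩ := R.exists_coordRing_lift (y ∘ w.symm) (by
      intro p hp
      have hle : R.I ≤ RingHom.ker (MvPolynomial.aeval (R := k)
          (y ∘ w.symm)) := by
        refine Ideal.map_le_iff_le_comap.2 fun q hq => ?_
        change MvPolynomial.aeval (y ∘ w.symm) (MvPolynomial.rename (w ∘ Sum.inl) q) = 0
        rw [hy, B.toCoordRing_eq_zero hq, TensorProduct.zero_tmul]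
      exact hle hp) (by
      change IsUnit (MvPolynomial.aeval (y ∘ w.symm) (MvPolynomial.rename (w ∘ Sum.inl) B.q))
      rw [hy]
      exact B.isUnit_toCoordRing.map (Algebra.TensorProduct.includeLeft :
        B.coordRing →ₐ[k] B.coordRing ⊗[k] MvPolynomial ρ k))
  have hz : ∀ p : MvPolynomial σ k,
      MvPolynomial.aeval (fun s => R.toCoordRing (MvPolynomial.X (w (Sum.inl s)))) p =
        R.toCoordRing (MvPolynomial.rename (w ∘ Sum.inl) p) := by
    intro p
    rw [← AlgHom.comp_apply]
    congr 1
    exact MvPolynomial.algHom_ext fun s => by simp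
  obtain ⟨α, hα⟩ := B.exists_coordRing_lift
    (fun s => R.toCoordRing (MvPolynomial.X (w (Sum.inl s))))
    (fun p hp => by
      rw [hz]
      exact toCoordRing_eq_zero _ (Ideal.mem_map_of_mem _ hp))
    (by rw [hz]; exact R.isUnit_toCoordRing)
  let ψ : B.coordRing ⊗[k] MvPolynomial ρ k →ₐ[k] R.coordRing :=
    Algebra.TensorProduct.lift α
      (MvPolynomial.aeval fun r => R.toCoordRing (MvPolynomial.X (w (Sum.inr r))))
      fun _ _ => Commute.all _ _
  rw [← KVariety.cls_affine_mvPolynomial]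
  refine KVariety.cls_affine_tensorProduct (AlgEquiv.ofAlgHom φ ψ ?_ ?_)
  · refine Algebra.TensorProduct.ext (coordRing_algHom_ext _ fun s => ?_)
      (MvPolynomial.algHom_ext fun r => ?_)
    · change φ (ψ (_ ⊗ₜ 1)) = _ ⊗ₜ 1
      simp [ψ, hα, hφ, y]
    · change φ (ψ (1 ⊗ₜ _)) = 1 ⊗ₜ _
      simp [ψ, hφ, y]
  · refine coordRing_algHom_ext _ fun t => ?_
    obtain ⟨x, rfl⟩ := w.surjective t
    rw [AlgHom.comp_apply, hφ, MvPolynomial.aeval_X, AlgHom.id_apply]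
    rcases x with s | r
    · simp [ψ, y, hα]
      rfl
    · simp [ψ, y]
      rfl

theorem cls_rename [Finite σ] [Finite τ] (B : BasicCondition k σ) {e : σ → τ}
    (he : Function.Injective e) :
    (B.rename e).cls = B.cls * affineLineClass k ^ (Nat.card τ - Nat.card σ) := by
  classical
  let w : σ ⊕ ((Set.range e)ᶜ : Set τ) ≃ τ :=
    ((Equiv.ofInjective e he).sumCongr (Equiv.refl _)).trans (Equiv.Set.sumCompl (Set.range e))
  have h := cls_rename_sum B w
  have he' : w ∘ Sum.inl = e := by
    ext s; simp [w]
  have hc : Nat.card τ = Nat.card σ + Nat.card ((Set.range e)ᶜ : Set τ) := by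
    rw [← Nat.card_congr w, Nat.card_sum]
  rw [he'] at h
  rw [h, hc, Nat.add_sub_cancel_left]

end Rename

/-! ### Preimages under rational maps -/

section Pullback

variable {K : Type u} [Field K] [Algebra k K]

theorem exists_clear_denominators (f : τ → MvPolynomial σ k) (g : MvPolynomial σ k)
    (p : MvPolynomial τ k) : ∃ (N : ℕ) (p' : MvPolynomial σ k), ∀ x : σ → K,
      MvPolynomial.aeval x g ≠ 0 → MvPolynomial.aeval x p' =
        MvPolynomial.aeval x g ^ N * MvPolynomial.aeval (ratEval f g x) p := by
  induction p using MvPolynomial.induction_on with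
  | C a => exact ⟨0, MvPolynomial.C a, fun x _ => by simp⟩
  | add p q hp hq =>
    obtain ⟨N, p', hp⟩ := hp
    obtain ⟨M, q', hq⟩ := hq
    refine ⟨N + M, g ^ M * p' + g ^ N * q', fun x hx => ?_⟩
    simp only [map_add, map_mul, map_pow, hp x hx, hq x hx]
    ring
  | mul_X p t hp =>
    obtain ⟨N, p', hp⟩ := hp
    refine ⟨N + 1, p' * f t, fun x hx => ?_⟩
    simp only [map_mul, hp x hx, MvPolynomial.aeval_X, ratEval]
    field_simp
    ring

/-- Each equation of C becomes polynomial after multiplication by a power of g. These powers change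
nothing, since g ≠ 0 is part of the new condition. -/
theorem exists_pullback (B : BasicCondition k σ) (C : BasicCondition k τ)
    (f : τ → MvPolynomial σ k) (g : MvPolynomial σ k) : ∃ D : BasicCondition k σ, ∀ x : σ → K,
      x ∈ D.points K ↔ x ∈ B.points K ∧ MvPolynomial.aeval x g ≠ 0 ∧
        ratEval f g x ∈ C.points K := by
  choose N p' hp' using exists_clear_denominators (K := K) f g
  refine ⟨⟨B.I ⊔ Ideal.span (p' '' C.I), B.q * (g * p' C.q)⟩, fun x => ?_⟩
  simp only [points, Set.mem_ofPred_eq, forall_mem_sup_aeval, forall_mem_span_aeval,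
    Set.forall_mem_image, map_mul, mul_ne_zero_iff]
  by_cases hg : MvPolynomial.aeval x g = 0
  · simp [hg]
  · simp only [hp' _ x hg, mul_eq_zero, pow_eq_zero_iff', hg, false_and, false_or, ne_eq,
      not_false_eq_true, true_and, SetLike.mem_coe]
    tauto

end Pullback

/-! ### Comparison of affine charts -/

section Cone

variable (K : Type u) [Field K] [Algebra k K]

/-- The cone over the points of `B` in the chart `x s = 1`. -/
def cone (B : BasicCondition k σ) (s : σ) : Set (σ → K) := {z | z s ≠ 0 ∧ (z s)⁻¹ • z ∈ B.points K}

variable {K}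

theorem apply_eq_one {B : BasicCondition k σ} {s : σ} (hs : MvPolynomial.X s - 1 ∈ B.I)
    {x : σ → K} (hx : x ∈ B.points K) : x s = 1 := by
  have := hx.1 _ hs
  rwa [map_sub, map_one, MvPolynomial.aeval_X, sub_eq_zero] at this

theorem mem_cone_of_mem_points {B : BasicCondition k σ} {s : σ}
    (hs : MvPolynomial.X s - 1 ∈ B.I) {x : σ → K} (hx : x ∈ B.points K) : x ∈ B.cone K s := by
  have h1 := apply_eq_one hs hx
  exact ⟨by simp [h1], by simpa [h1] using hx⟩

theorem smul_mem_cone {B : BasicCondition k σ} {s : σ} {z : σ → K} {a : K} (ha : a ≠ 0) :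
    a • z ∈ B.cone K s ↔ z ∈ B.cone K s := by
  have : (a * z s)⁻¹ • a • z = (z s)⁻¹ • z := by
    rw [smul_smul, mul_inv, mul_right_comm, inv_mul_cancel₀ ha, one_mul]
  simp only [cone, Set.mem_ofPred_eq, Pi.smul_apply, smul_eq_mul, this, mul_ne_zero_iff]
  tauto

theorem mem_cone_rename {B : BasicCondition k σ} {s : σ} (e : σ → τ) (z : τ → K) :
    z ∈ (B.rename e).cone K (e s) ↔ z ∘ e ∈ B.cone K s := by
  simp only [cone, Set.mem_ofPred_eq, mem_points_rename]
  rfl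

/-- The class of a constructible subset of projective space does not depend on its decomposition
into locally closed subsets of affine charts. -/
theorem sum_cls_eq_of_iUnion_cone_eq [IsAlgClosed K] [Finite σ] {ι ι' : Type} [Fintype ι]
    [Fintype ι'] {s : ι → σ} {B : ι → BasicCondition k σ} {s' : ι' → σ}
    {B' : ι' → BasicCondition k σ} (hs : ∀ i, MvPolynomial.X (s i) - 1 ∈ (B i).I)
    (hs' : ∀ i, MvPolynomial.X (s' i) - 1 ∈ (B' i).I)
    (hd : Pairwise fun i j => Disjoint ((B i).cone K (s i)) ((B j).cone K (s j)))
    (hd' : Pairwise fun i j => Disjoint ((B' i).cone K (s' i)) ((B' j).cone K (s' j)))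
    (hU : ⋃ i, (B i).cone K (s i) = ⋃ i, (B' i).cone K (s' i)) :
    ∑ i, (B i).cls = ∑ i, (B' i).cls := by
  have hr : ∀ (t : σ) (x : σ → K), ratEval (k := k) MvPolynomial.X (MvPolynomial.X t) x =
      (x t)⁻¹ • x := by
    intro t x
    ext u
    simp [ratEval, div_eq_inv_mul]
  -- The points of B whose line belongs to the piece C of the chart x t = 1: these are the cells of
  -- the common refinement, seen in the chart of B.
  have key : ∀ (B C : BasicCondition k σ) (t : σ), ∃ D : BasicCondition k σ, ∀ x : σ → K,
      x ∈ D.points K ↔ x ∈ B.points K ∧ x ∈ C.cone K t := by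
    intro B C t
    obtain ⟨D, hD⟩ := exists_pullback (K := K) B C MvPolynomial.X (MvPolynomial.X t)
    refine ⟨D, fun x => ?_⟩
    rw [hD, hr, MvPolynomial.aeval_X]
    rfl
  choose D hD using key
  have hdec : ∀ {ι ι' : Type} [Fintype ι] [Fintype ι'] {s : ι → σ}
      {B : ι → BasicCondition k σ} {s' : ι' → σ} {B' : ι' → BasicCondition k σ},
      (∀ i, MvPolynomial.X (s i) - 1 ∈ (B i).I) →
      (Pairwise fun i j => Disjoint ((B' i).cone K (s' i)) ((B' j).cone K (s' j))) →
      (⋃ i, (B i).cone K (s i) = ⋃ i, (B' i).cone K (s' i)) →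
      ∀ i, (B i).cls = ∑ j, (D (B i) (B' j) (s' j)).cls := by
    intro ι ι' _ _ s B s' B' hs hd' hU i
    refine cls_eq_sum_of_points_eq_iUnion K _ _ ?_ ?_
    · ext x
      simp only [Set.mem_iUnion, hD, exists_and_left]
      refine ⟨fun hx => ⟨hx, ?_⟩, fun hx => hx.1⟩
      rw [← Set.mem_iUnion, ← hU]
      exact Set.mem_iUnion.2 ⟨i, mem_cone_of_mem_points (hs i) hx⟩
    · intro j j' hj
      refine Set.disjoint_left.2 fun x hx hx' => ?_
      rw [hD] at hx hx'
      exact Set.disjoint_left.1 (hd' hj) hx.2 hx'.2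
  -- Each cell is visible in two charts. Dividing by x t passes from one to the other, and dividing
  -- by x s passes back because x s = 1 at the start.
  have hswap : ∀ {B C : BasicCondition k σ} {s t : σ}, MvPolynomial.X s - 1 ∈ B.I →
      ∀ x ∈ (D B C t).points K, MvPolynomial.aeval x (MvPolynomial.X t : MvPolynomial σ k) ≠ 0 ∧
      ratEval (k := k) MvPolynomial.X (MvPolynomial.X t) x ∈ (D C B s).points K ∧
      ratEval (k := k) MvPolynomial.X (MvPolynomial.X s)
        (ratEval (k := k) MvPolynomial.X (MvPolynomial.X t) x) = x := by
    intro B C s t hs x hx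
    rw [hD] at hx
    have h1 := apply_eq_one hs hx.1
    have ht : x t ≠ 0 := hx.2.1
    rw [hr, hr, hD, smul_mem_cone (inv_ne_zero ht), MvPolynomial.aeval_X]
    refine ⟨ht, ⟨hx.2.2, mem_cone_of_mem_points hs hx.1⟩, ?_⟩
    rw [smul_smul, Pi.smul_apply, smul_eq_mul, h1, mul_one, inv_inv, mul_inv_cancel₀ ht, one_smul]
  rw [Finset.sum_congr rfl fun i _ => hdec hs hd' hU i,
    Finset.sum_congr rfl fun i _ => hdec hs' hd hU.symm i, Finset.sum_comm]
  refine Finset.sum_congr rfl fun j _ => Finset.sum_congr rfl fun i _ => ?_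
  exact cls_eq_of_ratEval K _ _ _ _ _ _ (hswap (hs i)) (hswap (hs' j))

end Cone

end BasicCondition

/-! ## The motivic measure is well defined -/

theorem toMotivic_affineLineClass (k : Type u) [Field k] :
    toMotivic k (affineLineClass k) = (lefschetz k : MotivicRing k) := rfl

section Cylinders

variable {k : Type u} [Field k] {d : ℕ} {K : Type u} [Field K] [Algebra k K]

open BasicCondition

theorem jet_smul (n : Fin d → ℕ) (a : K) (z : BranchRing d K) : jet n (a • z) = a • jet n z := by
  ext p
  simp [jet]

theorem jet_ne_zero {n : Fin d → ℕ} {z : BranchRing d K} (h : jet n z ≠ 0) : z ≠ 0 := by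
  rintro rfl
  exact h (by ext p; simp [jet])

theorem jet_surjective (n : Fin d → ℕ) (y : JetIndex n → K) : ∃ z : BranchRing d K, jet n z = y := by
  refine ⟨fun i => PowerSeries.mk fun j => if h : j < n i + 1 then y ⟨i, ⟨j, h⟩⟩ else 0, ?_⟩
  ext ⟨i, j⟩
  have hj := j.2
  simp only [jet, PowerSeries.coeff_mk, hj, dite_true]

theorem mem_cone_ne_zero {σ : Type} {B : BasicCondition k σ} {s : σ} {z : σ → K}
    (h : z ∈ B.cone K s) : z ≠ 0 := by
  rintro rfl
  exact h.1 rfl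

theorem mk_mem_iff_mem_cone {σ : Type} {B : BasicCondition k σ} {s : σ}
    (hs : MvPolynomial.X s - 1 ∈ B.I) {z : σ → K} (hz : z ≠ 0) :
    (∃ x ∈ B.points K, ∃ h : x ≠ 0, Projectivization.mk K z hz = Projectivization.mk K x h) ↔
      z ∈ B.cone K s := by
  constructor
  · rintro ⟨x, hx, h, he⟩
    obtain ⟨a, rfl⟩ := (Projectivization.mk_eq_mk_iff' K _ _ _ _).1 he
    have ha : a ≠ 0 := by
      rintro rfl
      exact hz (zero_smul K x)
    exact (smul_mem_cone ha).2 (mem_cone_of_mem_points hs hx)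
  · intro h
    refine ⟨_, h.2, smul_ne_zero (inv_ne_zero h.1) hz, ?_⟩
    rw [Projectivization.mk_eq_mk_iff']
    exact ⟨z s, by rw [smul_smul, mul_inv_cancel₀ h.1, one_smul]⟩

/-- The data of a cylinder in terms of cones. -/
theorem hasMotivicMeasure_iff {X : Set (Projectivization K (BranchRing d K))} {a : MotivicRing k} :
    HasMotivicMeasure X a ↔ ∃ (n : Fin d → ℕ) (m : ℕ) (s : Fin m → JetIndex n)
      (B : Fin m → BasicCondition k (JetIndex n)),
      (∀ i, MvPolynomial.X (s i) - 1 ∈ (B i).I) ∧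
      (Pairwise fun i j => Disjoint ((B i).cone K (s i)) ((B j).cone K (s j))) ∧
      (∀ x, x ∈ X ↔ ∃ i, jet n x.rep ∈ (B i).cone K (s i)) ∧
      a = toMotivic k (∑ i, (B i).cls) *
        ((lefschetz k)⁻¹ ^ (∑ i, (n i + 1)) : (MotivicRing k)ˣ) := by
  constructor
  · rintro ⟨n, Y, b, rfl, ⟨m, s, B, Z, hs, hZ, hd, rfl, rfl⟩, rfl⟩
    refine ⟨n, m, s, B, hs, fun i j hij => Set.disjoint_left.2 fun z hi hj => ?_, fun x => ?_, rfl⟩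
    · have hz := mem_cone_ne_zero hi
      have hi' : Projectivization.mk K z hz ∈ Z i := by
        rw [hZ]; exact (mk_mem_iff_mem_cone (hs i) hz).2 hi
      have hj' : Projectivization.mk K z hz ∈ Z j := by
        rw [hZ]; exact (mk_mem_iff_mem_cone (hs j) hz).2 hj
      exact Set.disjoint_left.1 (hd hij) hi' hj'
    · simp only [projCylinder, hZ, Set.mem_iUnion, Set.mem_ofPred_eq]
      constructor
      · rintro ⟨h, i, hi⟩
        exact ⟨i, (mk_mem_iff_mem_cone (hs i) h).1 hi⟩
      · rintro ⟨i, hi⟩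
        exact ⟨mem_cone_ne_zero hi, i, (mk_mem_iff_mem_cone (hs i) (mem_cone_ne_zero hi)).2 hi⟩
  · rintro ⟨n, m, s, B, hs, hd, hX, rfl⟩
    refine ⟨n, ⋃ i, {y | ∃ x ∈ (B i).points K, ∃ h : x ≠ 0, y = Projectivization.mk K x h}, _, ?_,
      ⟨m, s, B, _, hs, fun i => rfl, ?_, rfl, rfl⟩, rfl⟩
    · ext x
      simp only [projCylinder, Set.mem_iUnion, Set.mem_ofPred_eq, hX]
      constructor
      · rintro ⟨i, hi⟩
        exact ⟨mem_cone_ne_zero hi, i, (mk_mem_iff_mem_cone (hs i) (mem_cone_ne_zero hi)).2 hi⟩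
      · rintro ⟨h, i, hi⟩
        exact ⟨i, (mk_mem_iff_mem_cone (hs i) h).1 hi⟩
    · intro i j hij
      refine Set.disjoint_left.2 fun y => ?_
      induction y using Projectivization.ind with
      | h z hz =>
        intro hi hj
        exact Set.disjoint_left.1 (hd hij) ((mk_mem_iff_mem_cone (hs i) hz).1 hi)
          ((mk_mem_iff_mem_cone (hs j) hz).1 hj)

/-- The projection of `N`-jets to `n`-jets for `n ≤ N`, on indices. -/
def jetEmb {n N : Fin d → ℕ} (h : n ≤ N) : JetIndex n → JetIndex N :=
  fun p => ⟨p.1, Fin.castLE (Nat.succ_le_succ (h p.1)) p.2⟩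

theorem jetEmb_injective {n N : Fin d → ℕ} (h : n ≤ N) : Function.Injective (jetEmb h) := by
  rintro ⟨i, a⟩ ⟨j, b⟩ hab
  simp only [jetEmb, Sigma.mk.injEq] at hab
  obtain ⟨rfl, hab⟩ := hab
  simpa using hab

theorem jet_comp_jetEmb {n N : Fin d → ℕ} (h : n ≤ N) (z : BranchRing d K) :
    jet N z ∘ jetEmb h = jet n z := rfl

theorem card_jetIndex (n : Fin d → ℕ) : Nat.card (JetIndex n) = ∑ i, (n i + 1) := by
  rw [Nat.card_sigma]
  simp

theorem mul_inv_pow_of_le {M : Type*} [CommMonoid M] (x : M) (u : Mˣ) {a b : ℕ} (h : a ≤ b) :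
    x * (u : M) ^ (b - a) * ((u⁻¹ ^ b : Mˣ) : M) = x * ((u⁻¹ ^ a : Mˣ) : M) := by
  obtain ⟨r, rfl⟩ := Nat.exists_eq_add_of_le h
  rw [Nat.add_sub_cancel_left, mul_assoc, ← Units.val_pow_eq_pow_val, ← Units.val_mul, pow_add,
    mul_comm (u⁻¹ ^ a), ← mul_assoc, ← mul_pow, mul_inv_cancel, one_pow, one_mul]

/-- Both descriptions are pulled back to the jets of level n ⊔ n', where the cones coincide because
every jet lifts. The class gains one factor 𝕃 for each added coordinate, which the normalization by
𝕃 ^ (-‖n + 1‖) removes. -/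
theorem hasMotivicMeasure_unique [IsAlgClosed K] {X : Set (Projectivization K (BranchRing d K))}
    {a a' : MotivicRing k} (h : HasMotivicMeasure X a) (h' : HasMotivicMeasure X a') : a = a' := by
  obtain ⟨n, m, s, B, hs, hd, hX, rfl⟩ := hasMotivicMeasure_iff.1 h
  obtain ⟨n', m', s', B', hs', hd', hX', rfl⟩ := hasMotivicMeasure_iff.1 h'
  have hn : n ≤ n ⊔ n' := le_sup_left
  have hn' : n' ≤ n ⊔ n' := le_sup_right
  have hren : ∀ {n N : Fin d → ℕ} (hn : n ≤ N) {s : JetIndex n} {B : BasicCondition k (JetIndex n)},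
      MvPolynomial.X s - 1 ∈ B.I → MvPolynomial.X (jetEmb hn s) - 1 ∈ (B.rename (jetEmb hn)).I := by
    intro n N hn s B hs
    have := Ideal.mem_map_of_mem
      (MvPolynomial.rename (jetEmb hn) : MvPolynomial _ k →ₐ[k] MvPolynomial _ k) hs
    rwa [map_sub, MvPolynomial.rename_X, map_one] at this
  have hdis : ∀ {n N : Fin d → ℕ} (hn : n ≤ N) {s t : JetIndex n}
      {B C : BasicCondition k (JetIndex n)}, Disjoint (B.cone K s) (C.cone K t) →
      Disjoint ((B.rename (jetEmb hn)).cone K (jetEmb hn s))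
        ((C.rename (jetEmb hn)).cone K (jetEmb hn t)) := by
    intro n N hn s t B C h
    refine Set.disjoint_left.2 fun z hz hz' => ?_
    rw [mem_cone_rename] at hz hz'
    exact Set.disjoint_left.1 h hz hz'
  have hmem : ∀ {n N : Fin d → ℕ} (hn : n ≤ N) {m : ℕ} {s : Fin m → JetIndex n}
      {B : Fin m → BasicCondition k (JetIndex n)},
      (∀ x, x ∈ X ↔ ∃ i, jet n x.rep ∈ (B i).cone K (s i)) → ∀ z (hz : jet N z ≠ 0),
      (jet N z ∈ ⋃ i, ((B i).rename (jetEmb hn)).cone K (jetEmb hn (s i)) ↔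
        Projectivization.mk K z (jet_ne_zero hz) ∈ X) := by
    intro n N hn m s B hX z hz
    -- The chosen representative of the line differs from z by a nonzero scalar, under which cones
    -- are invariant.
    obtain ⟨c, hc⟩ := Projectivization.exists_smul_eq_mk_rep K z (jet_ne_zero hz)
    simp only [Set.mem_iUnion, mem_cone_rename, jet_comp_jetEmb, hX, ← hc]
    refine exists_congr fun i => ?_
    rw [Units.smul_def, jet_smul, smul_mem_cone c.ne_zero]
  have hU : ⋃ i, ((B i).rename (jetEmb hn)).cone K (jetEmb hn (s i)) =
      ⋃ i, ((B' i).rename (jetEmb hn')).cone K (jetEmb hn' (s' i)) := by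
    ext y
    obtain ⟨z, rfl⟩ := jet_surjective (n ⊔ n') y
    by_cases hz : jet (n ⊔ n') z = 0
    · rw [hz]
      refine iff_of_false (fun h => ?_) fun h => ?_
      all_goals
        obtain ⟨i, hi⟩ := Set.mem_iUnion.1 h
        exact mem_cone_ne_zero hi rfl
    · rw [hmem hn hX z hz, hmem hn' hX' z hz]
  have key := sum_cls_eq_of_iUnion_cone_eq (fun i => hren hn (hs i)) (fun i => hren hn' (hs' i))
    (fun i j hij => hdis hn (hd hij)) (fun i j hij => hdis hn' (hd' hij)) hU
  simp only [cls_rename _ (jetEmb_injective _), ← Finset.sum_mul, card_jetIndex] at key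
  have key' := congrArg (fun x => toMotivic k x *
    ((lefschetz k)⁻¹ ^ (∑ i, ((n ⊔ n') i + 1)) : (MotivicRing k)ˣ)) key
  simp only [map_mul, map_pow, toMotivic_affineLineClass] at key'
  rwa [mul_inv_pow_of_le, mul_inv_pow_of_le] at key'
  · exact Finset.sum_le_sum fun i _ => Nat.succ_le_succ (hn' i)
  · exact Finset.sum_le_sum fun i _ => Nat.succ_le_succ (hn i)

theorem HasMotivicMeasure.genEulerChar_eq [IsAlgClosed K]
    {X : Set (Projectivization K (BranchRing d K))} {a : MotivicRing k}
    (h : HasMotivicMeasure X a) : genEulerChar k X = a := by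
  have hX : IsCylindric k X := ⟨a, h⟩
  rw [genEulerChar, dif_pos hX]
  exact hasMotivicMeasure_unique hX.choose_spec h

theorem hasMotivicMeasure_empty :
    HasMotivicMeasure (∅ : Set (Projectivization K (BranchRing d K))) (0 : MotivicRing k) :=
  hasMotivicMeasure_iff.2 ⟨0, 0, Fin.elim0, Fin.elim0, fun i => i.elim0, fun i => i.elim0,
    by simp, by simp⟩

/-- A cylinder over a locally closed subset of an affine chart. -/
theorem hasMotivicMeasure_of_mem_cone {X : Set (Projectivization K (BranchRing d K))}
    {n : Fin d → ℕ} {s : JetIndex n} {B : BasicCondition k (JetIndex n)}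
    (hs : MvPolynomial.X s - 1 ∈ B.I) (hX : ∀ x, x ∈ X ↔ jet n x.rep ∈ B.cone K s) :
    HasMotivicMeasure X (toMotivic k B.cls *
      (((lefschetz k)⁻¹ ^ (∑ i, (n i + 1)) : (MotivicRing k)ˣ) : MotivicRing k)) :=
  hasMotivicMeasure_iff.2 ⟨n, 1, fun _ => s, fun _ => B, fun _ => hs,
    fun i j hij => absurd (Subsingleton.elim i j) hij, by simpa using hX, by simp⟩

end Cylinders

/-! ## The conductor of a subalgebra of finite codimension -/

section Conductor

variable {k : Type u} [Field k] {d : ℕ} {O : Subalgebra k (BranchRing d k)}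

/-- Finitely many linear conditions on `a` ensure that `O` contains the ideal generated by `a`. -/
theorem exists_linearMap_ker_le (hfin : Module.Finite k (BranchRing d k ⧸ Subalgebra.toSubmodule O)) :
    ∃ (n : ℕ) (L : BranchRing d k →ₗ[k]
      (Option (Fin n) → BranchRing d k ⧸ Subalgebra.toSubmodule O)),
      ∀ a, L a = 0 → ∀ y, a * y ∈ O := by
  obtain ⟨n, s, hs⟩ := Module.Finite.exists_fin (R := k)
    (M := BranchRing d k ⧸ Subalgebra.toSubmodule O)
  choose b hb using fun i => Submodule.Quotient.mk_surjective _ (s i)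
  -- The b i generate the full ring modulo O. Since O is closed under products, a ∈ O together with
  -- all a * b i ∈ O implies that a times anything is in O.
  let b' : Option (Fin n) → BranchRing d k := fun o => o.elim 1 b
  refine ⟨n, LinearMap.pi fun o => (Submodule.mkQ _).comp (LinearMap.mulRight k (b' o)),
    fun a ha y => ?_⟩
  have h1 : ∀ o, a * b' o ∈ O := fun o => by
    have := congrFun ha o
    simpa using this
  have ha' : a ∈ O := by simpa [b'] using h1 none
  have hy : (Submodule.Quotient.mk y : BranchRing d k ⧸ Subalgebra.toSubmodule O) ∈
      Submodule.span k (Set.range s) := hs ▸ Submodule.mem_top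
  obtain ⟨c, hc⟩ := (Submodule.mem_span_range_iff_exists_fun k).1 hy
  have h2 : y - ∑ i, c i • b i ∈ O := by
    rw [← Subalgebra.mem_toSubmodule, ← Submodule.Quotient.mk_eq_zero, Submodule.Quotient.mk_sub,
      ← hc, sub_eq_zero, ← Submodule.mkQ_apply, map_sum]
    simp [hb]
  have h3 : a * y = a * (y - ∑ i, c i • b i) + ∑ i, c i • (a * b i) := by
    rw [mul_sub, Finset.mul_sum]
    simp
  rw [h3]
  exact O.add_mem (O.mul_mem ha' h2) (O.sum_mem fun i _ => O.smul_mem (h1 (some i)) _)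

/-- The polynomials on branch i form an infinite-dimensional space, so a nonzero one satisfies the
finitely many linear conditions that put its ideal inside O. It is a unit times a power of t_i. -/
theorem exists_single_X_pow_mul_mem
    (hfin : Module.Finite k (BranchRing d k ⧸ Subalgebra.toSubmodule O)) (i : Fin d) :
    ∃ m : ℕ, ∀ z : PowerSeries k, (Pi.single i (PowerSeries.X ^ m * z) : BranchRing d k) ∈ O := by
  obtain ⟨n, L, hL⟩ := exists_linearMap_ker_le hfin
  let F : Polynomial k →ₗ[k] BranchRing d k := (LinearMap.single k _ i).comp
    (Polynomial.coeToPowerSeries.algHom (R := k) k).toLinearMap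
  have hF : ∀ f : Polynomial k, F f = Pi.single i (f : PowerSeries k) := by
    intro f
    simp [F, Polynomial.coeToPowerSeries.algHom_apply]
  have hinj : ¬ Function.Injective (L.comp F) := fun h =>
    Polynomial.not_finite (R := k) (Module.Finite.of_injective _ h)
  rw [← LinearMap.ker_eq_bot, Submodule.eq_bot_iff] at hinj
  push Not at hinj
  obtain ⟨f, hf, hf0⟩ := hinj
  have hf0' : (f : PowerSeries k) ≠ 0 := by simpa using hf0
  obtain ⟨g, hg⟩ : (PowerSeries.X ^ (f : PowerSeries k).order.toNat : PowerSeries k) ∈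
      Set.range fun g => (f : PowerSeries k) * g := by
    refine ⟨(PowerSeries.divXPowOrder (f : PowerSeries k))⁻¹, ?_⟩
    have h0 : PowerSeries.constantCoeff (PowerSeries.divXPowOrder (f : PowerSeries k)) ≠ 0 := by
      rwa [Ne, PowerSeries.constantCoeff_divXPowOrder_eq_zero_iff]
    have h1 := PowerSeries.X_pow_order_mul_divXPowOrder (f := (f : PowerSeries k))
    have h2 := congrArg (· * (PowerSeries.divXPowOrder (f : PowerSeries k))⁻¹) h1.symm
    beta_reduce at h2 ⊢
    rwa [mul_assoc, PowerSeries.mul_inv_cancel _ h0, mul_one] at h2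
  refine ⟨(f : PowerSeries k).order.toNat, fun z => ?_⟩
  have := hL (F f) hf (Pi.single i (g * z))
  rw [hF, ← Pi.single_mul, ← mul_assoc] at this
  rw [← hg]
  exact this

/-- The conductor of the semigroup of values is contained in the conductor of the ring. -/
theorem single_mem_of_coeff_eq_zero
    (hfin : Module.Finite k (BranchRing d k ⧸ Subalgebra.toSubmodule O)) {c : Fin d → ℕ}
    (hc : ∀ n, c ≤ n → n ∈ valueSemigroup O) (i : Fin d) (z : PowerSeries k)
    (hz : ∀ j < c i, PowerSeries.coeff j z = 0) : (Pi.single i z : BranchRing d k) ∈ O := by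
  choose m hm using exists_single_X_pow_mul_mem hfin
  have hdvd : ∀ l (y : PowerSeries k), (∀ j < m l, PowerSeries.coeff j y = 0) →
      (Pi.single l y : BranchRing d k) ∈ O := by
    intro l y hy
    obtain ⟨w, rfl⟩ := PowerSeries.X_pow_dvd_iff.2 hy
    exact hm l w
  -- Take an element of O of order N on branch i and of order at least m on the others. Its
  -- components on the other branches already lie in O and can be subtracted.
  have hex : ∀ N, c i ≤ N → ∃ y : PowerSeries k, y.order = N ∧
      (Pi.single i y : BranchRing d k) ∈ O := by
    intro N hN
    obtain ⟨y, hy, hord⟩ := hc (Function.update (c ⊔ m) i N) (fun l => by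
      rcases eq_or_ne l i with rfl | hl
      · simpa using hN
      · simp [hl])
    refine ⟨y i, by simpa using hord i, ?_⟩
    have h1 : (Pi.single i (y i) : BranchRing d k) =
        y - ∑ l ∈ Finset.univ.erase i, Pi.single l (y l) := by
      rw [eq_sub_iff_add_eq, Finset.add_sum_erase _ (fun l => (Pi.single l (y l) :
        BranchRing d k)) (Finset.mem_univ i), Finset.univ_sum_single]
    rw [h1]
    refine O.sub_mem hy (O.sum_mem fun l hl => hdvd l _ fun j hj => ?_)
    refine PowerSeries.coeff_of_lt_order _ ?_
    rw [hord l, Function.update_of_ne (Finset.ne_of_mem_erase hl)]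
    exact_mod_cast hj.trans_le (le_max_right _ _)
  -- The threshold descends from m i to c i one degree at a time: an element of O of order exactly N
  -- cancels the coefficient of degree N.
  have key : ∀ r (y : PowerSeries k), (∀ j < max (c i) (m i - r), PowerSeries.coeff j y = 0) →
      (Pi.single i y : BranchRing d k) ∈ O := by
    intro r
    induction r with
    | zero => exact fun y hy => hdvd i y fun j hj => hy j (hj.trans_le (le_max_right _ _))
    | succ r ih =>
      intro y hy
      by_cases hN : max (c i) (m i - r) ≤ max (c i) (m i - (r + 1))
      · exact ih y fun j hj => hy j (hj.trans_le hN)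
      obtain ⟨w, hw, hwO⟩ := hex (m i - (r + 1)) (by omega)
      obtain ⟨hw0, hw1⟩ := PowerSeries.order_eq_nat.1 hw
      set N := m i - (r + 1) with hNdef
      have h1 := ih (y - (PowerSeries.coeff N y / PowerSeries.coeff N w) • w) fun j hj => by
        rcases Nat.lt_or_ge j N with h | h
        · simp [hy j (by omega), hw1 j h]
        · obtain rfl : j = N := by omega
          simp [hw0]
      have h2 := O.add_mem h1 (O.smul_mem hwO (PowerSeries.coeff N y / PowerSeries.coeff N w))
      rwa [← Pi.single_smul, ← Pi.single_add, sub_add_cancel] at h2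
  exact key (m i) z fun j hj => hz j (by simpa using hj)

theorem mem_of_coeff_eq_zero
    (hfin : Module.Finite k (BranchRing d k ⧸ Subalgebra.toSubmodule O)) {c : Fin d → ℕ}
    (hc : ∀ n, c ≤ n → n ∈ valueSemigroup O) (z : BranchRing d k)
    (hz : ∀ i, ∀ j < c i, PowerSeries.coeff j (z i) = 0) : z ∈ O := by
  rw [← Finset.univ_sum_single z]
  exact O.sum_mem fun i _ => single_mem_of_coeff_eq_zero hfin hc i _ (hz i)

end Conductor

/-! ## Linear forms -/

section Forms

variable {k : Type u} [Field k] {d : ℕ}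

theorem evalForm_eq_sum {R : Type u} [CommRing R] [Algebra k R] (l : Fin d × ℕ →₀ k)
    (z : BranchRing d R) :
    evalForm l z = ∑ p ∈ l.support, l p • PowerSeries.coeff p.2 (z p.1) := rfl

theorem evalForm_eq_linearCombination {R : Type u} [CommRing R] [Algebra k R]
    (l : Fin d × ℕ →₀ k) (z : BranchRing d R) :
    evalForm l z = Finsupp.linearCombination k (fun p => PowerSeries.coeff p.2 (z p.1)) l := rfl

theorem coeff_single_X_pow {R : Type u} [CommRing R] (p : Fin d × ℕ) (i : Fin d) (j : ℕ) :
    PowerSeries.coeff j ((Pi.single p.1 (PowerSeries.X ^ p.2) : BranchRing d R) i) =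
      if p = (i, j) then 1 else 0 := by
  rcases eq_or_ne p.1 i with rfl | hi
  · rw [Pi.single_eq_same, PowerSeries.coeff_X_pow]
    refine if_congr ?_ rfl rfl
    rw [Prod.ext_iff]
    simp [eq_comm]
  · rw [Pi.single_eq_of_ne hi.symm, map_zero, if_neg]
    rintro rfl
    exact hi rfl

theorem evalForm_add {R : Type u} [CommRing R] [Algebra k R] (l : Fin d × ℕ →₀ k)
    (z y : BranchRing d R) : evalForm l (z + y) = evalForm l z + evalForm l y := by
  simp [evalForm_eq_sum, Finset.sum_add_distrib]

theorem evalForm_mul_left {R : Type u} [CommRing R] [Algebra k R] (l : Fin d × ℕ →₀ k) (r : R)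
    (z : BranchRing d R) : evalForm l (r • z) = r * evalForm l z := by
  simp [evalForm_eq_sum, Finset.mul_sum]

/-- The linear forms with coefficients in `k` vanishing on `O`. -/
def annihilatorForms (O : Subalgebra k (BranchRing d k)) : Submodule k (Fin d × ℕ →₀ k) where
  carrier := {l | ∀ y ∈ O, evalForm l y = 0}
  zero_mem' := fun y _ => by simp [evalForm]
  add_mem' := fun {l m} hl hm y hy => by
    rw [evalForm_eq_linearCombination, map_add, ← evalForm_eq_linearCombination,
      ← evalForm_eq_linearCombination, hl y hy, hm y hy, add_zero]
  smul_mem' := fun a l hl y hy => by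
    rw [evalForm_eq_linearCombination, map_smul, ← evalForm_eq_linearCombination, hl y hy,
      smul_zero]

/-- Forms vanishing on `O` only involve coefficients below the conductor. -/
theorem apply_eq_zero_of_mem_annihilatorForms {O : Subalgebra k (BranchRing d k)}
    (hfin : Module.Finite k (BranchRing d k ⧸ Subalgebra.toSubmodule O)) {c : Fin d → ℕ}
    (hc : ∀ n, c ≤ n → n ∈ valueSemigroup O) {l : Fin d × ℕ →₀ k} (hl : l ∈ annihilatorForms O)
    {i : Fin d} {j : ℕ} (hj : c i ≤ j) : l (i, j) = 0 := by
  have h := hl _ (single_mem_of_coeff_eq_zero hfin hc i (PowerSeries.X ^ j) fun j' hj' => by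
    rw [PowerSeries.coeff_X_pow, if_neg]
    omega)
  rw [evalForm_eq_sum, Finset.sum_eq_single (i, j)] at h
  · simpa using h
  · rintro p - hne
    rw [coeff_single_X_pow (i, j), if_neg fun h => hne h.symm, smul_zero]
  · intro h0
    rw [Finsupp.notMem_support_iff.1 h0, zero_smul]

/-- `O` is cut out by linear forms. -/
theorem mem_ringPoints_self {O : Subalgebra k (BranchRing d k)}
    (hfin : Module.Finite k (BranchRing d k ⧸ Subalgebra.toSubmodule O)) {c : Fin d → ℕ}
    (hc : ∀ n, c ≤ n → n ∈ valueSemigroup O) {z : BranchRing d k} :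
    z ∈ ringPoints O k ↔ z ∈ O := by
  refine ⟨fun hz => ?_, fun hz l hl => hl z hz⟩
  by_contra hzO
  obtain ⟨f, hf, hle⟩ := Submodule.exists_le_ker_of_notMem (p := Subalgebra.toSubmodule O) hzO
  let S : Finset (Fin d × ℕ) := Finset.univ.sigma (fun i => Finset.range (c i)) |>.map
    (Equiv.sigmaEquivProd (Fin d) ℕ).toEmbedding
  have hS : ∀ i j, (i, j) ∈ S ↔ j < c i := by
    intro i j
    simp only [S, Finset.mem_map_equiv]
    simp
  let mono : Fin d × ℕ → BranchRing d k := fun p => Pi.single p.1 (PowerSeries.X ^ p.2)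
  -- The separating functional f kills everything beyond the conductor, hence is determined by its
  -- values on the finitely many monomials below it, which are the coefficients of l.
  let l : Fin d × ℕ →₀ k := ∑ p ∈ S, Finsupp.single p (f (mono p))
  have hcoeff : ∀ (y : BranchRing d k) (i : Fin d) (j : ℕ), PowerSeries.coeff j
      ((∑ p ∈ S, PowerSeries.coeff p.2 (y p.1) • mono p) i) =
      if j < c i then PowerSeries.coeff j (y i) else 0 := by
    intro y i j
    simp only [Finset.sum_apply, map_sum, Pi.smul_apply, PowerSeries.coeff_smul, mono,
      coeff_single_X_pow, smul_eq_mul, mul_ite, mul_one, mul_zero, Finset.sum_ite_eq', hS]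
  have hl : ∀ y, evalForm l y = f y := by
    intro y
    have h0 : y - ∑ p ∈ S, PowerSeries.coeff p.2 (y p.1) • mono p ∈ O := by
      refine mem_of_coeff_eq_zero hfin hc _ fun i j hj => ?_
      rw [Pi.sub_apply, map_sub, hcoeff, if_pos hj, sub_self]
    have h1 := hle h0
    rw [LinearMap.mem_ker, map_sub, sub_eq_zero] at h1
    rw [h1, map_sum, evalForm_eq_linearCombination, map_sum]
    refine Finset.sum_congr rfl fun p _ => ?_
    rw [Finsupp.linearCombination_single, map_smul, smul_eq_mul, smul_eq_mul, mul_comm]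
  refine hf ?_
  rw [← hl]
  exact hz l fun y hy => by
    rw [hl]
    exact hle hy

end Forms

/-! ## The motivic measure of the set of elements of given value -/

section Strata

variable {k : Type u} [Field k] {d : ℕ}

/-- The coordinate `a_{j,i}` on the space of `N`-jets; it is `0` for `j > N i`. -/
noncomputable def jetCoord (k : Type u) [Field k] (N : Fin d → ℕ) (i : Fin d) (j : ℕ) :
    MvPolynomial (JetIndex N) k :=
  if h : j < N i + 1 then MvPolynomial.X ⟨i, ⟨j, h⟩⟩ else 0

/-- The coefficients of a jet, extended by `0`. -/
def jetCoeff {K : Type u} [Field K] {N : Fin d → ℕ} (x : JetIndex N → K) (i : Fin d) (j : ℕ) : K :=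
  if h : j < N i + 1 then x ⟨i, ⟨j, h⟩⟩ else 0

section

variable {K : Type u} [Field K] {N : Fin d → ℕ}

theorem jetCoeff_val (x : JetIndex N → K) (p : JetIndex N) : jetCoeff x p.1 p.2 = x p :=
  dif_pos p.2.2

theorem jetCoeff_jet (z : BranchRing d K) {i : Fin d} {j : ℕ} (h : j ≤ N i) :
    jetCoeff (jet N z) i j = PowerSeries.coeff j (z i) :=
  dif_pos (Nat.lt_succ_of_le h)

theorem jetCoeff_smul (a : K) (x : JetIndex N → K) (i : Fin d) (j : ℕ) :
    jetCoeff (a • x) i j = a * jetCoeff x i j := by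
  unfold jetCoeff
  split_ifs <;> simp

variable [Algebra k K]

theorem aeval_jetCoord (x : JetIndex N → K) (i : Fin d) (j : ℕ) :
    MvPolynomial.aeval x (jetCoord k N i j) = jetCoeff x i j := by
  unfold jetCoeff jetCoord
  split_ifs <;> simp

/-- The conditions on the coefficients for `O` to contain an element with value `n`, normalized at
the branch `i₀`. -/
def HasValueForm (O : Subalgebra k (BranchRing d k)) (i₀ : Fin d) (n : Fin d → ℕ)
    (w : Fin d → ℕ → K) : Prop :=
  (∀ i, ∀ j < n i, w i j = 0) ∧ w i₀ (n i₀) = 1 ∧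
    (∀ l ∈ annihilatorForms O, ∑ p ∈ l.support, l p • w p.1 p.2 = 0) ∧ ∀ i, w i (n i) ≠ 0

end

/-- The jets of elements of `O` of value `n`, normalized at the branch `i₀`. -/
noncomputable def valueCondition (O : Subalgebra k (BranchRing d k)) (i₀ : Fin d)
    (N n : Fin d → ℕ) : BasicCondition k (JetIndex N) where
  I := Ideal.span (({p | ∃ i, ∃ j < n i, p = jetCoord k N i j} ∪ {jetCoord k N i₀ (n i₀) - 1}) ∪
    {p | ∃ l ∈ annihilatorForms O, p = ∑ q ∈ l.support, l q • jetCoord k N q.1 q.2})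
  q := ∏ i, jetCoord k N i (n i)

variable {K : Type u} [Field K] [Algebra k K]

theorem mem_points_valueCondition (O : Subalgebra k (BranchRing d k)) (i₀ : Fin d)
    (N n : Fin d → ℕ) (x : JetIndex N → K) :
    x ∈ (valueCondition O i₀ N n).points K ↔ HasValueForm O i₀ n (jetCoeff x) := by
  simp only [BasicCondition.points, valueCondition, Set.mem_ofPred_eq,
    BasicCondition.forall_mem_span_aeval, Set.mem_union, or_imp, forall_and, map_prod,
    aeval_jetCoord, Finset.prod_ne_zero_iff, HasValueForm, Set.mem_singleton_iff, forall_eq,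
    map_sub, map_one, sub_eq_zero, Finset.mem_univ, true_imp_iff, and_assoc]
  refine and_congr ?_ (and_congr Iff.rfl (and_congr ?_ Iff.rfl))
  · constructor
    · intro h i j hj
      rw [← aeval_jetCoord (k := k)]
      exact h _ ⟨i, j, hj, rfl⟩
    · rintro h _ ⟨i, j, hj, rfl⟩
      rw [aeval_jetCoord]
      exact h i j hj
  · constructor
    · intro h l hl
      have := h _ ⟨l, hl, rfl⟩
      simpa only [map_sum, map_smul, aeval_jetCoord] using this
    · rintro h _ ⟨l, hl, rfl⟩
      simpa only [map_sum, map_smul, aeval_jetCoord] using h l hl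

/-- The set of points of `ℙ𝒪` of value `n`. -/
def valueStratum (O : Subalgebra k (BranchRing d k)) (K : Type u) [Field K] [Algebra k K]
    (n : Fin d → ℕ) : Set (Projectivization K (BranchRing d K)) :=
  {x | x.rep ∈ ringPoints O K ∧ ∀ i, (x.rep i).order = n i}

variable {O : Subalgebra k (BranchRing d k)} {c : Fin d → ℕ}

/-- The bound c ≤ N makes the equations of O visible on the N-jet and n ≤ N does the same for the
orders. Dividing by the leading coefficient on branch i₀ moves the stratum into one chart. -/
theorem hasMotivicMeasure_valueStratum
    (hO : ∀ l ∈ annihilatorForms O, ∀ i j, c i ≤ j → l (i, j) = 0) (i₀ : Fin d)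
    {N n : Fin d → ℕ} (hc : c ≤ N) (hn : n ≤ N) :
    HasMotivicMeasure (valueStratum O K n) (toMotivic k (valueCondition O i₀ N n).cls *
      (((lefschetz k)⁻¹ ^ (∑ i, (N i + 1)) : (MotivicRing k)ˣ) : MotivicRing k)) := by
  have h0 : n i₀ < N i₀ + 1 := Nat.lt_succ_of_le (hn i₀)
  refine hasMotivicMeasure_of_mem_cone (s := ⟨i₀, ⟨n i₀, h0⟩⟩) (Ideal.subset_span ?_) fun x => ?_
  · refine Or.inl (Or.inr ?_)
    rw [jetCoord, dif_pos h0, Set.mem_singleton_iff]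
  · simp only [BasicCondition.cone, Set.mem_ofPred_eq, mem_points_valueCondition, valueStratum]
    set z := x.rep
    have hz : jet N z ⟨i₀, ⟨n i₀, h0⟩⟩ = PowerSeries.coeff (n i₀) (z i₀) := rfl
    have hform : ∀ l ∈ annihilatorForms O, ∀ a : K,
        ∑ p ∈ l.support, l p • (a * jetCoeff (jet N z) p.1 p.2) = a * evalForm l z := by
      intro l hl a
      rw [evalForm_eq_sum, Finset.mul_sum]
      refine Finset.sum_congr rfl fun p hp => ?_
      have : p.2 ≤ N p.1 := by
        by_contra hlt
        exact Finsupp.mem_support_iff.1 hp (hO l hl p.1 p.2 ((hc p.1).trans (not_le.1 hlt).le))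
      rw [jetCoeff_jet _ this, mul_smul_comm]
    rw [hz]
    simp only [HasValueForm, jetCoeff_smul]
    constructor
    · rintro ⟨hzO, hord⟩
      have hord' := fun i => PowerSeries.order_eq_nat.1 (hord i)
      refine ⟨(hord' i₀).1, fun i j hj => ?_, ?_, fun l hl => ?_, fun i => ?_⟩
      · rw [jetCoeff_jet _ (hj.le.trans (hn i)), (hord' i).2 j hj, mul_zero]
      · rw [jetCoeff_jet _ (hn i₀), inv_mul_cancel₀ (hord' i₀).1]
      · rw [hform l hl, hzO l hl, mul_zero]
      · rw [jetCoeff_jet _ (hn i)]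
        exact mul_ne_zero (inv_ne_zero (hord' i₀).1) (hord' i).1
    · rintro ⟨hne, h1, -, h3, h4⟩
      refine ⟨fun l hl => ?_, fun i => PowerSeries.order_eq_nat.2 ⟨?_, fun j hj => ?_⟩⟩
      · have := h3 l hl
        rw [hform l hl] at this
        exact (mul_eq_zero.1 this).resolve_left (inv_ne_zero hne)
      · have := h4 i
        rw [jetCoeff_jet _ (hn i)] at this
        exact right_ne_zero_of_mul this
      · have := h1 i j hj
        rw [jetCoeff_jet _ (hj.le.trans (hn i))] at this
        exact (mul_eq_zero.1 this).resolve_left (inv_ne_zero hne)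

/-- Multiplication by `t_a` beyond the conductor. -/
theorem cls_valueCondition_add_single
    (hO : ∀ l ∈ annihilatorForms O, ∀ i j, c i ≤ j → l (i, j) = 0) (i₀ a : Fin d)
    {N n : Fin d → ℕ} (ha : c a ≤ n a) :
    (valueCondition O i₀ (N + Pi.single a 1) (n + Pi.single a 1)).cls =
      (valueCondition O i₀ N n).cls := by
  let K := AlgebraicClosure k
  -- `f` is multiplication by t_a on branch a, and `f'` below is division by it; the other branches
  -- are left alone.
  let f : JetIndex (N + Pi.single a 1) → MvPolynomial (JetIndex N) k := fun p =>
    if p.1 = a then (if (p.2 : ℕ) = 0 then 0 else jetCoord k N a (p.2 - 1))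
      else jetCoord k N p.1 p.2
  let f' : JetIndex N → MvPolynomial (JetIndex (N + Pi.single a 1)) k := fun p =>
    if p.1 = a then jetCoord k _ a (p.2 + 1) else jetCoord k _ p.1 p.2
  have hf : ∀ (x : JetIndex N → K) i j, jetCoeff (fun p => MvPolynomial.aeval x (f p)) i j =
      if i = a then (if j = 0 then 0 else jetCoeff x a (j - 1)) else jetCoeff x i j := by
    intro x i j
    by_cases hj : j < (N + Pi.single a 1 : Fin d → ℕ) i + 1
    · rw [jetCoeff, dif_pos hj]
      simp only [f]
      split_ifs <;> simp [aeval_jetCoord]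
    · rw [jetCoeff, dif_neg hj]
      split_ifs with h1 h2
      · rfl
      · subst h1
        simp only [Pi.add_apply, Pi.single_eq_same] at hj
        rw [jetCoeff, dif_neg (by omega)]
      · simp only [Pi.add_apply, Pi.single_eq_of_ne h1] at hj
        rw [jetCoeff, dif_neg (by omega)]
  have hf' : ∀ (x : JetIndex (N + Pi.single a 1) → K) i j,
      jetCoeff (fun p => MvPolynomial.aeval x (f' p)) i j =
      if i = a then jetCoeff x a (j + 1) else jetCoeff x i j := by
    intro x i j
    by_cases hj : j < N i + 1
    · rw [jetCoeff, dif_pos hj]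
      simp only [f']
      split_ifs <;> simp [aeval_jetCoord]
    · rw [jetCoeff, dif_neg hj]
      split_ifs with h1
      · subst h1
        rw [jetCoeff, dif_neg (by simp only [Pi.add_apply, Pi.single_eq_same]; omega)]
      · rw [jetCoeff, dif_neg (by simp only [Pi.add_apply, Pi.single_eq_of_ne h1]; omega)]
  refine BasicCondition.cls_eq_of_polyEval K _ _ f' f (fun y hy => ⟨?_, fun p => ?_⟩)
    fun x hx => ⟨?_, fun p => ?_⟩
  · rw [mem_points_valueCondition] at hy ⊢
    obtain ⟨h1, h2, h3, h4⟩ := hy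
    refine ⟨fun i j hj => ?_, ?_, fun l hl => ?_, fun i => ?_⟩
    · rw [hf']
      split_ifs with hi
      · subst hi
        exact h1 i (j + 1) (by simpa using hj)
      · exact h1 i j (by simpa [hi] using hj)
    · rw [hf']
      split_ifs with hi
      · subst hi
        simpa using h2
      · simpa [hi] using h2
    · rw [← h3 l hl]
      refine Finset.sum_congr rfl fun p hp => ?_
      rw [hf']
      split_ifs with hi
      -- An equation of O involves branch a only in degrees below c a ≤ n a, where the coefficients
      -- vanish both before and after the shift.
      · have hlt : p.2 < n a := by
          by_contra hge
          refine Finsupp.mem_support_iff.1 hp (hO l hl p.1 p.2 ?_)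
          rw [hi]
          omega
        rw [hi, h1 a (p.2 + 1) (by simpa using hlt),
          h1 a p.2 (by simp only [Pi.add_apply, Pi.single_eq_same]; omega)]
      · rfl
    · have := h4 i
      rw [hf']
      split_ifs with hi
      · subst hi
        simpa using this
      · simpa [hi] using this
  · rw [mem_points_valueCondition] at hy
    have h1 := hy.1 a 0 (by simp)
    rw [← jetCoeff_val (fun s => MvPolynomial.aeval _ (f s)) p, ← jetCoeff_val y p]
    simp only [hf, hf', if_true]
    split_ifs with hi h0
    · rw [h0, hi, h1]
    · rw [Nat.sub_add_cancel (Nat.pos_of_ne_zero h0)]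
      exact congrArg (fun i => jetCoeff y i (p.2 : ℕ)) hi.symm
    · rfl
  · rw [mem_points_valueCondition] at hx ⊢
    obtain ⟨h1, h2, h3, h4⟩ := hx
    refine ⟨fun i j hj => ?_, ?_, fun l hl => ?_, fun i => ?_⟩
    · rw [hf]
      split_ifs with hi h0
      · rfl
      · subst hi
        simp only [Pi.add_apply, Pi.single_eq_same] at hj
        exact h1 i (j - 1) (by omega)
      · exact h1 i j (by simpa [hi] using hj)
    · rw [hf]
      split_ifs with hi h0
      · subst hi
        simp at h0
      · subst hi
        simpa using h2
      · simpa [hi] using h2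
    · rw [← h3 l hl]
      refine Finset.sum_congr rfl fun p hp => ?_
      rw [hf]
      by_cases hi : p.1 = a
      · have hlt : p.2 < n a := by
          by_contra hge
          refine Finsupp.mem_support_iff.1 hp (hO l hl p.1 p.2 ?_)
          rw [hi]
          omega
        rw [if_pos hi, hi, h1 a p.2 hlt, h1 a (p.2 - 1) (by omega), ite_self]
      · rw [if_neg hi]
    · have := h4 i
      rw [hf]
      split_ifs with hi h0
      · subst hi
        simp at h0
      · subst hi
        simpa using this
      · simpa [hi] using this
  · rw [← jetCoeff_val (fun s => MvPolynomial.aeval _ (f' s)) p, ← jetCoeff_val x p]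
    simp only [hf, hf', if_true]
    split_ifs with hi
    · simp_all
    · simp_all
    · rfl

/-- The complement of the coordinate hyperplanes. -/
noncomputable def torusCondition (k : Type u) [Field k] (ι : Type) [Fintype ι] :
    BasicCondition k ι := ⟨⊥, ∏ i, MvPolynomial.X i⟩

theorem mem_points_torusCondition {ι : Type} [Fintype ι] (x : ι → K) :
    x ∈ (torusCondition k ι).points K ↔ ∀ i, x i ≠ 0 := by
  simp [BasicCondition.points, torusCondition, Finset.prod_ne_zero_iff]

/-- In a c-jet of value c only the coefficient of degree c i survives on each branch, and no
equation of O involves it. What remains is nonzero leading coefficients, with the one on i₀ equal to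
1. -/
theorem cls_valueCondition_conductor
    (hO : ∀ l ∈ annihilatorForms O, ∀ i j, c i ≤ j → l (i, j) = 0) (i₀ : Fin d) :
    (valueCondition O i₀ c c).cls = (torusCondition k {i // i ≠ i₀}).cls := by
  let K := AlgebraicClosure k
  let f' : JetIndex c → MvPolynomial {i // i ≠ i₀} k := fun p =>
    if (p.2 : ℕ) = c p.1 then (if h : p.1 ≠ i₀ then MvPolynomial.X ⟨p.1, h⟩ else 1) else 0
  have hf' : ∀ (x : {i // i ≠ i₀} → K) i j,
      jetCoeff (fun p => MvPolynomial.aeval x (f' p)) i j =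
      if j = c i then (if h : i ≠ i₀ then x ⟨i, h⟩ else 1) else 0 := by
    intro x i j
    by_cases hj : j < c i + 1
    · rw [jetCoeff, dif_pos hj]
      simp only [f']
      split_ifs <;> simp
    · rw [jetCoeff, dif_neg hj, if_neg (by omega)]
  refine BasicCondition.cls_eq_of_polyEval K _ _ (fun i => jetCoord k c i (c i)) f'
    (fun x hx => ?_) fun y hy => ?_
  · rw [mem_points_valueCondition] at hx
    obtain ⟨h1, h2, -, h4⟩ := hx
    refine ⟨(mem_points_torusCondition _).2 fun i => ?_, fun p => ?_⟩
    · rw [aeval_jetCoord]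
      exact h4 i
    · rw [← jetCoeff_val (fun s => MvPolynomial.aeval _ (f' s)) p, hf', ← jetCoeff_val x p]
      split_ifs with hp hi
      · rw [aeval_jetCoord, hp]
      · rw [not_not] at hi
        rw [hp, hi, h2]
      · have := p.2.2
        rw [h1 p.1 p.2 (by omega)]
  · rw [mem_points_torusCondition] at hy
    refine ⟨(mem_points_valueCondition _ _ _ _ _).2 ⟨fun i j hj => ?_, ?_, fun l hl => ?_,
      fun i => ?_⟩, fun i => ?_⟩
    · rw [hf', if_neg hj.ne]
    · rw [hf', if_pos rfl, dif_neg (not_not.2 rfl)]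
    · refine Finset.sum_eq_zero fun p hp => ?_
      have : p.2 ≠ c p.1 := fun h =>
        Finsupp.mem_support_iff.1 hp (hO l hl p.1 p.2 h.ge)
      rw [hf', if_neg this, smul_zero]
    · rw [hf', if_pos rfl]
      split_ifs with h
      · exact hy _
      · exact one_ne_zero
    · rw [aeval_jetCoord, hf', if_pos rfl, dif_pos i.2]

end Strata

/-! ## Power series with eventually geometric coefficients -/

section Geometric

variable {M : Type*} [CommRing M] {d : ℕ}

open Classical in
/-- The power series `∏ i ∈ A, (1 - u X_i)⁻¹`. -/
noncomputable def geometricSeries (u : M) (A : Finset (Fin d)) : MvPowerSeries (Fin d) M :=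
  fun f => if ∀ i, i ∉ A → f i = 0 then u ^ f.degree else 0

theorem coeff_geometricSeries (u : M) (A : Finset (Fin d)) (f : Fin d →₀ ℕ)
    [Decidable (∀ i, i ∉ A → f i = 0)] :
    MvPowerSeries.coeff f (geometricSeries u A) =
      if ∀ i, i ∉ A → f i = 0 then u ^ f.degree else 0 := by
  rw [MvPowerSeries.coeff_apply, geometricSeries]
  congr

theorem C_mul_X_eq_monomial (u : M) (i : Fin d) :
    MvPowerSeries.C u * MvPowerSeries.X i = MvPowerSeries.monomial (Finsupp.single i 1) u := by
  rw [MvPowerSeries.X_def, ← MvPowerSeries.monomial_zero_eq_C_apply,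
    MvPowerSeries.monomial_mul_monomial, zero_add, mul_one]

theorem geometricSeries_insert_mul (u : M) (A : Finset (Fin d)) {i : Fin d} (hi : i ∉ A) :
    geometricSeries u (insert i A) * (1 - MvPowerSeries.C u * MvPowerSeries.X i) =
      geometricSeries u A := by
  classical
  ext f
  rw [C_mul_X_eq_monomial, mul_sub, mul_one, map_sub, MvPowerSeries.coeff_mul_monomial]
  simp only [coeff_geometricSeries, Finset.mem_insert, not_or, and_imp]
  by_cases h0 : f i = 0
  · have h1 : ¬ Finsupp.single i 1 ≤ f := fun h => by
      have := h i
      simp [h0] at this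
    rw [if_neg h1, sub_zero]
    refine if_congr (forall_congr' fun l => ?_) rfl rfl
    constructor
    · intro h hl
      rcases eq_or_ne l i with rfl | hli
      · exact h0
      · exact h hli hl
    · exact fun h _ hl => h hl
  · have h1 : Finsupp.single i 1 ≤ f := by
      rw [Finsupp.single_le_iff]
      omega
    obtain ⟨g, rfl⟩ := exists_add_of_le h1
    have h3 : ¬ ∀ l, l ∉ A → (Finsupp.single i 1 + g : Fin d →₀ ℕ) l = 0 := fun h => h0 (h i hi)
    rw [if_pos h1, add_tsub_cancel_left, if_neg h3, sub_eq_zero]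
    have h2 : (∀ l, ¬ l = i → l ∉ A → (Finsupp.single i 1 + g : Fin d →₀ ℕ) l = 0) ↔
        ∀ l, ¬ l = i → l ∉ A → g l = 0 := by
      refine forall_congr' fun l => forall_congr' fun hl => ?_
      rw [Finsupp.add_apply, Finsupp.single_eq_of_ne hl, zero_add]
    rw [ite_mul, zero_mul, if_congr h2 rfl rfl, ← pow_succ]
    simp [map_add, Finsupp.degree_single, add_comm]

theorem geometricSeries_mul_prod (u : M) (A : Finset (Fin d)) :
    geometricSeries u A * ∏ i ∈ A, (1 - MvPowerSeries.C u * MvPowerSeries.X i) = 1 := by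
  classical
  induction A using Finset.induction_on with
  | empty =>
    rw [Finset.prod_empty, mul_one]
    ext f
    rw [coeff_geometricSeries, MvPowerSeries.coeff_one]
    by_cases h : f = 0
    · simp [h]
    · rw [if_neg h, if_neg]
      intro h'
      exact h (Finsupp.ext fun i => h' i (by simp))
  | insert i A hi ih =>
    rw [Finset.prod_insert hi, ← mul_assoc, geometricSeries_insert_mul u A hi, ih]

/-- The increment f moves only coordinates already beyond c, so the one-step rule applies at each
unit step whatever the order. -/
theorem eq_pow_mul_of_step {u : M} {χ : (Fin d →₀ ℕ) → M} {c : Fin d →₀ ℕ}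
    (hχ : ∀ n a, c a ≤ n a → χ (n + Finsupp.single a 1) = u * χ n) (n f : Fin d →₀ ℕ)
    (h : ∀ i, f i ≠ 0 → c i ≤ n i) : χ (n + f) = u ^ f.degree * χ n := by
  obtain ⟨r, hr⟩ : ∃ r, f.degree = r := ⟨_, rfl⟩
  induction r generalizing f with
  | zero =>
    rw [Finsupp.degree_eq_zero_iff] at hr
    simp [hr]
  | succ r ih =>
    have hf : f ≠ 0 := by
      rintro rfl
      simp at hr
    obtain ⟨i, hi⟩ := Finsupp.ne_iff.1 hf
    rw [Finsupp.zero_apply] at hi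
    obtain ⟨g, rfl⟩ : ∃ g, f = g + Finsupp.single i 1 := by
      refine ⟨f - Finsupp.single i 1, (tsub_add_cancel_of_le ?_).symm⟩
      rw [Finsupp.single_le_iff]
      omega
    have hg : g.degree = r := by simpa [map_add, Finsupp.degree_single] using hr
    rw [← add_assoc, hχ, ih g (fun l hl => h l (by simp [hl])) hg, ← mul_assoc, ← pow_succ', hr,
      hg]
    exact (h i hi).trans (by simp)

/-- A power series whose coefficients are geometric beyond `c` in each variable is a rational
function. -/
theorem exists_mvPolynomial_of_step (L : Mˣ) {P : MvPowerSeries (Fin d) M}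
    {χ : (Fin d →₀ ℕ) → M} (hPχ : ∀ n, MvPowerSeries.coeff n P = χ n) {c : Fin d →₀ ℕ}
    (hχ : ∀ n a, c a ≤ n a → χ (n + Finsupp.single a 1) = ((L⁻¹ : Mˣ) : M) * χ n) :
    ∃ Q : MvPolynomial (Fin d) M,
      P * ∏ i, (1 - MvPowerSeries.C ((L⁻¹ : Mˣ) : M) * MvPowerSeries.X i) =
        (Q : MvPowerSeries (Fin d) M) ∧
      Q.totalDegree ≤ c.degree ∧
      MvPolynomial.eval (fun _ => (L : M)) Q = (L : M) ^ c.degree * χ c := by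
  classical
  set u : M := ((L⁻¹ : Mˣ) : M) with hu
  let A : (Fin d →₀ ℕ) → Finset (Fin d) := fun n => Finset.univ.filter fun i => n i = c i
  have hA : ∀ n i, i ∉ A n ↔ n i ≠ c i := fun n i => by simp [A]
  -- Every exponent e is uniquely n + f with n ≤ c and f supported where n i = c i, namely with n =
  -- e ⊓ c.
  have hP : P = ∑ n ∈ Finset.Icc 0 c, MvPowerSeries.monomial n (χ n) * geometricSeries u (A n) := by
    ext e
    rw [hPχ, map_sum]
    simp only [MvPowerSeries.coeff_monomial_mul, coeff_geometricSeries]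
    rw [Finset.sum_eq_single (e ⊓ c)]
    · have h1 : e ⊓ c + (e - e ⊓ c) = e := add_tsub_cancel_of_le inf_le_left
      have h2 := eq_pow_mul_of_step hχ (e ⊓ c) (e - e ⊓ c) fun i hi => by
        simp only [Finsupp.tsub_apply, Finsupp.inf_apply] at hi ⊢
        omega
      rw [h1] at h2
      rw [if_pos inf_le_left, if_pos, mul_comm, ← h2]
      intro i hi
      rw [hA, Finsupp.inf_apply] at hi
      rw [Finsupp.tsub_apply, Finsupp.inf_apply]
      omega
    · intro n hn hne
      rw [Finset.mem_Icc] at hn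
      by_cases hle : n ≤ e
      · rw [if_pos hle, if_neg, mul_zero]
        intro h
        refine hne (Finsupp.ext fun i => ?_)
        have h1 := h i
        have h2 := hle i
        have h3 := hn.2 i
        rw [hA, Finsupp.tsub_apply] at h1
        rw [Finsupp.inf_apply]
        by_cases h4 : n i = c i
        · omega
        · have := h1 h4
          omega
      · rw [if_neg hle]
    · intro h
      exact absurd (Finset.mem_Icc.2 ⟨zero_le, inf_le_right⟩) h
  refine ⟨∑ n ∈ Finset.Icc 0 c, MvPolynomial.monomial n (χ n) *
    ∏ i ∈ (A n)ᶜ, (1 - MvPolynomial.C u * MvPolynomial.X i), ?_, ?_, ?_⟩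
  · rw [hP, Finset.sum_mul, ← MvPolynomial.coeToMvPowerSeries.ringHom_apply, map_sum]
    refine Finset.sum_congr rfl fun n _ => ?_
    rw [← Finset.prod_mul_prod_compl (A n), mul_assoc, ← mul_assoc (geometricSeries u (A n)),
      geometricSeries_mul_prod, one_mul, map_mul, map_prod]
    simp only [MvPolynomial.coeToMvPowerSeries.ringHom_apply, MvPolynomial.coe_monomial,
      map_sub, map_mul, map_one, MvPolynomial.coe_C, MvPolynomial.coe_X]
  · refine MvPolynomial.totalDegree_finsetSum_le fun n hn => ?_
    rw [Finset.mem_Icc] at hn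
    refine (MvPolynomial.totalDegree_mul _ _).trans ?_
    have h1 : (MvPolynomial.monomial n (χ n)).totalDegree ≤ n.degree :=
      MvPolynomial.totalDegree_monomial_le _ _
    have h2 : (∏ i ∈ (A n)ᶜ, (1 - MvPolynomial.C u * MvPolynomial.X i) :
        MvPolynomial (Fin d) M).totalDegree ≤ ∑ i ∈ (A n)ᶜ, 1 := by
      refine (MvPolynomial.totalDegree_finsetProd _ _).trans (Finset.sum_le_sum fun i _ => ?_)
      refine (MvPolynomial.totalDegree_sub _ _).trans (max_le (by simp) ?_)
      rw [MvPolynomial.C_mul_X_eq_monomial]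
      exact (MvPolynomial.totalDegree_monomial_le _ _).trans (by simp)
    refine (add_le_add h1 h2).trans ?_
    rw [Finsupp.degree_eq_sum, Finsupp.degree_eq_sum, ← Finset.sum_add_sum_compl (A n) (fun i => c i),
      ← Finset.sum_add_sum_compl (A n) (fun i => n i), add_assoc, ← Finset.sum_add_distrib]
    -- Each factor 1 - u X_i raises the degree by at most one and occurs only where n i < c i, so n
    -- i + 1 ≤ c i pays for it.
    refine add_le_add (Finset.sum_le_sum fun i _ => hn.2 i) (Finset.sum_le_sum fun i hi => ?_)
    exact lt_of_le_of_ne (hn.2 i) ((hA n i).1 (Finset.mem_compl.1 hi))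
  · rw [map_sum, Finset.sum_eq_single c]
    · have : (A c)ᶜ = ∅ := by simp [A]
      rw [this, Finset.prod_empty, mul_one, MvPolynomial.eval_monomial, mul_comm,
        Finsupp.prod_pow, Finset.prod_pow_eq_pow_sum, Finsupp.degree_eq_sum]
    -- If n ≠ c, some n i < c i, and the factor 1 - L⁻¹ X_i vanishes at X_i = L.
    · intro n hn hne
      obtain ⟨i, hi⟩ := Finsupp.ne_iff.1 hne
      rw [map_mul, map_prod, Finset.prod_eq_zero (i := i), mul_zero]
      · simpa [A] using hi
      · simp [hu]
    · intro h
      exact absurd (Finset.mem_Icc.2 ⟨zero_le, le_rfl⟩) h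

end Geometric

/-! ## The coefficients of the generalized Poincaré series -/

section Integral

variable {k : Type u} [Field k] {d : ℕ} {O : Subalgebra k (BranchRing d k)}
  {K : Type u} [Field K] [Algebra k K]

theorem valMonomial_eq_monomial_iff (x : Projectivization K (BranchRing d K)) (e : Fin d →₀ ℕ) :
    valMonomial x = MvPowerSeries.monomial e 1 ↔ ∀ i, (x.rep i).order = e i := by
  rw [valMonomial]
  split_ifs with h
  · constructor
    · intro he i
      have h1 : Finsupp.equivFunOnFinite.symm (fun i => (x.rep i).order.toNat) = e := by
        by_contra hne
        have := congrArg (MvPowerSeries.coeff e) he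
        rw [MvPowerSeries.coeff_monomial_same, MvPowerSeries.coeff_monomial_ne (Ne.symm hne)] at this
        exact zero_ne_one this
      rw [← h1, Finsupp.equivFunOnFinite_symm_apply_apply, PowerSeries.coe_toNat_order (h i)]
    · intro he
      congr 2
      ext i
      rw [Finsupp.equivFunOnFinite_symm_apply_apply, he i, ENat.toNat_natCast]
  · refine iff_of_false (fun he => ?_) fun he => h fun i h0 => ?_
    · have := congrArg (MvPowerSeries.coeff e) he
      rw [MvPowerSeries.coeff_monomial_same, map_zero] at this
      exact zero_ne_one this
    · have := he i
      rw [h0, PowerSeries.order_zero] at this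
      exact ENat.top_ne_natCast _ this

theorem exists_eq_monomial_of_valMonomial_ne_zero {x : Projectivization K (BranchRing d K)}
    (h : valMonomial x ≠ 0) : ∃ e, valMonomial x = MvPowerSeries.monomial e 1 := by
  rw [valMonomial] at h ⊢
  split_ifs at h ⊢ with h1
  · exact ⟨_, rfl⟩
  · exact absurd rfl h

theorem projRing_inter_preimage_monomial (e : Fin d →₀ ℕ) :
    projRing O K ∩ valMonomial ⁻¹' {MvPowerSeries.monomial e 1} = valueStratum O K e := by
  ext x
  simp only [Set.mem_inter_iff, Set.mem_preimage, Set.mem_singleton_iff,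
    valMonomial_eq_monomial_iff]
  rfl

theorem inter_preimage_eq_empty_or (X : Set (Projectivization K (BranchRing d K)))
    {a : MvPowerSeries (Fin d) ℤ} (ha : a ≠ 0) :
    X ∩ valMonomial ⁻¹' {a} = ∅ ∨ ∃ e, a = MvPowerSeries.monomial e 1 := by
  refine (Set.eq_empty_or_nonempty _).imp id ?_
  rintro ⟨x, -, rfl⟩
  exact exists_eq_monomial_of_valMonomial_ne_zero ha

theorem monomial_one_ne_zero (e : Fin d →₀ ℕ) :
    (MvPowerSeries.monomial e 1 : MvPowerSeries (Fin d) ℤ) ≠ 0 := fun h => by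
  have := congrArg (MvPowerSeries.coeff e) h
  rw [MvPowerSeries.coeff_monomial_same, map_zero] at this
  exact one_ne_zero this

/-- The nonzero values of the integrand are monomials with coefficient 1, whose level sets are the
strata, and only T ^ e contributes to the coefficient of exponent e. -/
theorem isMotivicIntegrable_valMonomial (h : ∀ n, IsCylindric k (valueStratum O K n)) :
    IsMotivicIntegrable k (projRing O K) valMonomial := by
  refine ⟨fun a ha => ?_, fun e => (Set.finite_singleton (MvPowerSeries.monomial e 1)).subset ?_⟩
  · rcases inter_preimage_eq_empty_or (projRing O K) ha with h0 | ⟨e, rfl⟩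
    · rw [h0]
      exact ⟨0, hasMotivicMeasure_empty⟩
    · rw [projRing_inter_preimage_monomial]
      exact h _
  · rintro a ⟨ha, hea, hne⟩
    rcases inter_preimage_eq_empty_or (projRing O K) ha with h0 | ⟨e', rfl⟩
    · exact absurd hne (by simp [h0])
    · by_cases hee : e = e'
      · rw [hee]; rfl
      · exact absurd (MvPowerSeries.coeff_monomial_ne hee _) hea

theorem genPoincareSeries_apply [IsAlgClosed K] (e : Fin d →₀ ℕ) :
    genPoincareSeries O K e = genEulerChar k (valueStratum O K e) := by
  classical
  rw [genPoincareSeries, motivicIntegral, finsum_eq_single _ (MvPowerSeries.monomial e 1)]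
  · rw [finsum_eq_if, if_pos (monomial_one_ne_zero e), MvPowerSeries.coeff_monomial_same, one_zsmul,
      projRing_inter_preimage_monomial]
  · intro a hae
    rw [finsum_eq_if]
    split_ifs with ha
    · rcases inter_preimage_eq_empty_or (projRing O K) ha with h0 | ⟨e', rfl⟩
      · rw [h0, hasMotivicMeasure_empty.genEulerChar_eq, zsmul_zero]
      · rw [MvPowerSeries.coeff_monomial_ne, zero_zsmul]
        rintro rfl
        exact hae rfl
    · rfl

end Integral

/-! ## The algebra of points of `O` with coefficients in a `k`-algebra -/

section RingPoints

variable {k : Type u} [Field k] {d : ℕ} {O : Subalgebra k (BranchRing d k)}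

/-- The form `y ↦ l (z * y)` with coefficients in `R`. -/
noncomputable def mulForm {R : Type u} [CommRing R] [Algebra k R] (l : Fin d × ℕ →₀ k)
    (z : BranchRing d R) : Fin d × ℕ →₀ R :=
  ∑ p ∈ l.support, ∑ x ∈ Finset.HasAntidiagonal.antidiagonal p.2,
    Finsupp.single (p.1, x.2) (l p • PowerSeries.coeff x.1 (z p.1))

theorem linearCombination_mulForm {R : Type u} [CommRing R] [Algebra k R] (l : Fin d × ℕ →₀ k)
    (z y : BranchRing d R) :
    Finsupp.linearCombination R (fun p => PowerSeries.coeff p.2 (y p.1)) (mulForm l z) =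
      evalForm l (z * y) := by
  rw [mulForm, map_sum, evalForm_eq_sum]
  refine Finset.sum_congr rfl fun p _ => ?_
  rw [map_sum, Pi.mul_apply, PowerSeries.coeff_mul, Finset.smul_sum]
  refine Finset.sum_congr rfl fun x _ => ?_
  rw [Finsupp.linearCombination_single, smul_eq_mul, smul_mul_assoc]

theorem evalForm_coeffMap {A R : Type u} [CommRing A] [Algebra k A] [CommRing R] [Algebra k R]
    (φ : A →ₐ[k] R) (l : Fin d × ℕ →₀ k) (z : BranchRing d A) :
    evalForm l (coeffMap d φ z) = φ (evalForm l z) := by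
  rw [evalForm_eq_sum, evalForm_eq_sum, map_sum]
  refine Finset.sum_congr rfl fun p _ => ?_
  rw [map_smul]
  rfl

theorem coeffMap_mem_ringPoints {A R : Type u} [CommRing A] [Algebra k A] [CommRing R]
    [Algebra k R] (φ : A →ₐ[k] R) {z : BranchRing d A} (hz : z ∈ ringPoints O A) :
    coeffMap d φ z ∈ ringPoints O R := fun l hl => by
  rw [evalForm_coeffMap, hz l hl, map_zero]

theorem evalForm_eq_sum_of_subset {R : Type u} [CommRing R] [Algebra k R] {l : Fin d × ℕ →₀ k}
    {S : Finset (Fin d × ℕ)} (h : l.support ⊆ S) (z : BranchRing d R) :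
    evalForm l z = ∑ p ∈ S, l p • PowerSeries.coeff p.2 (z p.1) :=
  Finsupp.sum_of_support_subset _ h _ fun _ _ => zero_smul k _

/-- A form with coefficients in `R` that vanishes on `O` vanishes on the points of `O` in `R`. -/
theorem linearCombination_eq_zero_of_mem_ringPoints {R : Type u} [CommRing R] [Algebra k R]
    (r : Fin d × ℕ →₀ R)
    (hr : ∀ y ∈ O, Finsupp.linearCombination R
      (fun p => PowerSeries.coeff p.2 (coeffMap d (Algebra.ofId k R) y p.1)) r = 0)
    {z : BranchRing d R} (hz : z ∈ ringPoints O R) :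
    Finsupp.linearCombination R (fun p => PowerSeries.coeff p.2 (z p.1)) r = 0 := by
  classical
  -- Expanding the coefficients of r in a k-basis of R splits it into forms over k, each of which
  -- vanishes on O and therefore on O_R by definition.
  let e := Module.Free.chooseBasis k R
  let l : Module.Free.ChooseBasisIndex k R → (Fin d × ℕ →₀ k) := fun b =>
    r.mapRange (e.coord b) (map_zero _)
  have hsupp : ∀ b, (l b).support ⊆ r.support := fun b => Finsupp.support_mapRange
  have hl : ∀ b, l b ∈ annihilatorForms O := by
    intro b y hy
    have h := congrArg (e.coord b) (hr y hy)
    rw [map_zero, Finsupp.linearCombination_apply, Finsupp.sum, map_sum] at h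
    rw [evalForm_eq_sum_of_subset (hsupp b), ← h]
    refine Finset.sum_congr rfl fun p _ => ?_
    have : r p • PowerSeries.coeff p.2 (coeffMap d (Algebra.ofId k R) y p.1) =
        PowerSeries.coeff p.2 (y p.1) • r p := by
      rw [smul_eq_mul, mul_comm, Algebra.smul_def]
      rfl
    rw [this, map_smul, smul_eq_mul, smul_eq_mul, mul_comm]
    rfl
  let T := r.support.biUnion fun p => (e.repr (r p)).support
  have hT : ∀ p ∈ r.support, r p = ∑ b ∈ T, l b p • e b := by
    intro p hp
    conv_lhs => rw [← e.linearCombination_repr (r p), Finsupp.linearCombination_apply]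
    exact Finsupp.sum_of_support_subset _ (Finset.subset_biUnion_of_mem
      (fun p => (e.repr (r p)).support) hp) _ fun _ _ => zero_smul k _
  have hsum : ∀ b, evalForm (l b) z = ∑ p ∈ r.support, l b p • PowerSeries.coeff p.2 (z p.1) :=
    fun b => evalForm_eq_sum_of_subset (hsupp b) z
  rw [Finsupp.linearCombination_apply, Finsupp.sum]
  have h1 : ∀ p ∈ r.support, r p • PowerSeries.coeff p.2 (z p.1) =
      ∑ b ∈ T, e b * (l b p • PowerSeries.coeff p.2 (z p.1)) := by
    intro p hp
    conv_lhs => rw [hT p hp]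
    rw [smul_eq_mul, Finset.sum_mul]
    refine Finset.sum_congr rfl fun b _ => ?_
    rw [smul_mul_assoc, mul_smul_comm]
  rw [Finset.sum_congr rfl h1, Finset.sum_comm]
  refine Finset.sum_eq_zero fun b _ => ?_
  rw [← Finset.mul_sum, ← hsum, hz _ (hl b), mul_zero]

/-- The map (z, y) ↦ l (z * y) is bilinear and vanishes on O × O. Extending scalars in one factor
and then in the other gives vanishing on O_R × O_R. -/
theorem mul_mem_ringPoints {R : Type u} [CommRing R] [Algebra k R] {z y : BranchRing d R}
    (hz : z ∈ ringPoints O R) (hy : y ∈ ringPoints O R) : z * y ∈ ringPoints O R := by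
  intro l hl
  rw [← linearCombination_mulForm]
  refine linearCombination_eq_zero_of_mem_ringPoints _ (fun y' hy' => ?_) hy
  rw [linearCombination_mulForm, mul_comm, ← linearCombination_mulForm]
  refine linearCombination_eq_zero_of_mem_ringPoints _ (fun z' hz' => ?_) hz
  rw [linearCombination_mulForm, ← map_mul, evalForm_coeffMap, hl _ (O.mul_mem hy' hz'), map_zero]

theorem one_mem_ringPoints {R : Type u} [CommRing R] [Algebra k R] :
    (1 : BranchRing d R) ∈ ringPoints O R := by
  rw [← map_one (coeffMap d (Algebra.ofId k R))]
  exact coeffMap_mem_ringPoints _ fun l hl => hl 1 O.one_mem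

/-- If two branches had different constant terms a and b, then z - a and z - b would be nonunits of
O differing by a nonzero constant, which a local ring forbids. -/
theorem constantCoeff_eq_of_mem [IsLocalRing O] {z : BranchRing d k} (hz : z ∈ O) (i j : Fin d) :
    PowerSeries.constantCoeff (z i) = PowerSeries.constantCoeff (z j) := by
  by_contra hne
  let y : k → O := fun a => ⟨z, hz⟩ - algebraMap k O a
  have hval : ∀ a l, PowerSeries.constantCoeff ((y a : BranchRing d k) l) =
      PowerSeries.constantCoeff (z l) - a := by
    intro a l
    simp only [y, AddSubgroupClass.coe_sub, Pi.sub_apply, map_sub]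
    congr 1
  have hnot : ∀ l, ¬ IsUnit (y (PowerSeries.constantCoeff (z l))) := by
    intro l hu
    have h1 := ((hu.map O.val).map (Pi.evalRingHom _ l)).map (PowerSeries.constantCoeff (R := k))
    refine h1.ne_zero ?_
    have := hval (PowerSeries.constantCoeff (z l)) l
    rw [sub_self] at this
    exact this
  have hu : IsUnit (y (PowerSeries.constantCoeff (z i)) + -y (PowerSeries.constantCoeff (z j))) := by
    have : y (PowerSeries.constantCoeff (z i)) + -y (PowerSeries.constantCoeff (z j)) =
        algebraMap k O (PowerSeries.constantCoeff (z j) - PowerSeries.constantCoeff (z i)) := by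
      simp only [y, map_sub]
      ring
    rw [this]
    exact (IsUnit.mk0 _ (sub_ne_zero.2 (Ne.symm hne))).map _
  rcases IsLocalRing.isUnit_or_isUnit_of_isUnit_add hu with h | h
  · exact hnot i h
  · exact hnot j (by simpa using h.neg)

theorem single_sub_single_mem_annihilatorForms [IsLocalRing O] (i j : Fin d) :
    Finsupp.single (i, 0) 1 - Finsupp.single (j, 0) 1 ∈ annihilatorForms O := by
  intro z hz
  rw [evalForm_eq_linearCombination, map_sub, Finsupp.linearCombination_single,
    Finsupp.linearCombination_single, one_smul, one_smul, sub_eq_zero]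
  simpa using constantCoeff_eq_of_mem hz i j

theorem constantCoeff_eq_of_mem_ringPoints [IsLocalRing O] {R : Type u} [CommRing R] [Algebra k R]
    {z : BranchRing d R} (hz : z ∈ ringPoints O R) (i j : Fin d) :
    PowerSeries.constantCoeff (z i) = PowerSeries.constantCoeff (z j) := by
  have := hz _ (single_sub_single_mem_annihilatorForms i j)
  rw [evalForm_eq_linearCombination, map_sub, Finsupp.linearCombination_single,
    Finsupp.linearCombination_single, one_smul, one_smul, sub_eq_zero] at this
  simpa using this

end RingPoints

/-! ## Pivots of the linear equations of `O` -/

section Pivots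

variable {k : Type u} [Field k] {d : ℕ}

/-- The index `x` is the largest one, in the lexicographic order, occurring in some linear form
vanishing on `O`. -/
def IsPivot (O : Subalgebra k (BranchRing d k)) (x : Fin d ×ₗ ℕ) : Prop :=
  ∃ l ∈ annihilatorForms O, l (ofLex x) = 1 ∧ ∀ y, x < y → l (ofLex y) = 0

/-- The set of pivots. -/
abbrev Pivot (O : Subalgebra k (BranchRing d k)) : Type := {x : Fin d ×ₗ ℕ // IsPivot O x}

variable {O : Subalgebra k (BranchRing d k)}

/-- A linear form with given pivot. -/
noncomputable def pivotForm (p : Pivot O) : Fin d × ℕ →₀ k := p.2.choose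

theorem pivotForm_mem (p : Pivot O) : pivotForm p ∈ annihilatorForms O := p.2.choose_spec.1

theorem pivotForm_apply_self (p : Pivot O) : pivotForm p (ofLex p.1) = 1 := p.2.choose_spec.2.1

theorem pivotForm_apply_of_lt (p : Pivot O) {y : Fin d ×ₗ ℕ} (h : p.1 < y) :
    pivotForm p (ofLex y) = 0 := p.2.choose_spec.2.2 y h

theorem exists_max_of_ne_zero {l : Fin d × ℕ →₀ k} (hl : l ≠ 0) :
    ∃ x : Fin d ×ₗ ℕ, l (ofLex x) ≠ 0 ∧ ∀ y, x < y → l (ofLex y) = 0 := by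
  obtain ⟨p, hp, hmax⟩ := Finset.exists_max_image l.support (fun p => (toLex p : Fin d ×ₗ ℕ))
    (Finsupp.support_nonempty_iff.2 hl)
  refine ⟨toLex p, Finsupp.mem_support_iff.1 hp, fun y hy => ?_⟩
  by_contra h
  exact not_le.2 hy (hmax (ofLex y) (Finsupp.mem_support_iff.2 h))

/-- Gaussian elimination: subtracting a multiple of the pivot form with the same leading index
lowers that index, and the lexicographic order is well founded. -/
theorem mem_span_pivotForm {l : Fin d × ℕ →₀ k} (hl : l ∈ annihilatorForms O) :
    l ∈ Submodule.span k (Set.range (pivotForm (O := O))) := by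
  by_cases hl0 : l = 0
  · rw [hl0]
    exact Submodule.zero_mem _
  obtain ⟨x, hx, hmax⟩ := exists_max_of_ne_zero hl0
  induction x using WellFoundedLT.induction generalizing l with
  | ind x ih =>
    let p : Pivot O := ⟨x, (l (ofLex x))⁻¹ • l, (annihilatorForms O).smul_mem _ hl,
      by simp [inv_mul_cancel₀ hx], fun y hy => by simp [hmax y hy]⟩
    have hp : pivotForm p ∈ Submodule.span k (Set.range (pivotForm (O := O))) :=
      Submodule.subset_span ⟨p, rfl⟩
    set m := l - l (ofLex x) • pivotForm p with hm
    have hmem : m ∈ annihilatorForms O :=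
      (annihilatorForms O).sub_mem hl ((annihilatorForms O).smul_mem _ (pivotForm_mem p))
    have hm0 : ∀ y, x ≤ y → m (ofLex y) = 0 := by
      intro y hy
      rw [hm, Finsupp.sub_apply, Finsupp.smul_apply, smul_eq_mul]
      rcases hy.eq_or_lt with rfl | hy
      · rw [pivotForm_apply_self p, mul_one, sub_self]
      · rw [hmax y hy, pivotForm_apply_of_lt p hy, mul_zero, sub_zero]
    have hlm : l = m + l (ofLex x) • pivotForm p := (sub_add_cancel _ _).symm
    rw [hlm]
    refine Submodule.add_mem _ ?_ (Submodule.smul_mem _ _ hp)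
    by_cases h0 : m = 0
    · rw [h0]
      exact Submodule.zero_mem _
    obtain ⟨y, hy, hymax⟩ := exists_max_of_ne_zero h0
    have hyx : y < x := by
      by_contra h
      exact hy (hm0 y (not_lt.1 h))
    exact ih y hyx hmem h0 hy hymax

theorem mem_ringPoints_iff_pivotForm {R : Type u} [CommRing R] [Algebra k R]
    {z : BranchRing d R} : z ∈ ringPoints O R ↔ ∀ p : Pivot O, evalForm (pivotForm p) z = 0 := by
  refine ⟨fun hz p => hz _ (pivotForm_mem p), fun h l hl => ?_⟩
  have : Submodule.span k (Set.range (pivotForm (O := O))) ≤ LinearMap.ker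
      (Finsupp.linearCombination k fun p : Fin d × ℕ => PowerSeries.coeff p.2 (z p.1)) := by
    rw [Submodule.span_le]
    rintro _ ⟨p, rfl⟩
    exact h p
  exact this (mem_span_pivotForm hl)

/-- The monomial `t_i ^ j` for `p = (i, j)`. -/
noncomputable def branchMonomial (R : Type u) [CommRing R] (p : Fin d × ℕ) : BranchRing d R :=
  Pi.single p.1 (PowerSeries.X ^ p.2)

theorem coeff_branchMonomial_mul {R : Type u} [CommRing R] (p s : Fin d × ℕ) (g : BranchRing d R) :
    PowerSeries.coeff s.2 ((branchMonomial R p * g) s.1) =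
      if s.1 = p.1 ∧ p.2 ≤ s.2 then PowerSeries.coeff (s.2 - p.2) (g s.1) else 0 := by
  rw [Pi.mul_apply, branchMonomial]
  by_cases h : s.1 = p.1
  · rw [h, Pi.single_eq_same, PowerSeries.coeff_X_pow_mul']
    simp
  · rw [Pi.single_eq_of_ne h, zero_mul, map_zero, if_neg fun h' => h h'.1]

/-- Multiples of t_i ^ j have coefficients only on branch i in degrees at least j, hence at indices
lexicographically at or after q > p, where the form of p is zero. -/
theorem evalForm_pivotForm_of_lt {R : Type u} [CommRing R] [Algebra k R] {p q : Pivot O}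
    (h : p < q) (g : BranchRing d R) :
    evalForm (pivotForm p) (branchMonomial R (ofLex q.1) * g) = 0 := by
  rw [evalForm_eq_sum]
  refine Finset.sum_eq_zero fun s hs => ?_
  rw [coeff_branchMonomial_mul, if_neg, smul_zero]
  rintro ⟨h1, h2⟩
  refine Finsupp.mem_support_iff.1 hs (pivotForm_apply_of_lt p (y := toLex s)
    (lt_of_lt_of_le h ?_))
  rw [Prod.Lex.le_iff]
  exact Or.inr ⟨h1.symm, h2⟩

theorem evalForm_pivotForm_self {R : Type u} [CommRing R] [Algebra k R] (p : Pivot O)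
    (g : BranchRing d R) :
    evalForm (pivotForm p) (branchMonomial R (ofLex p.1) * g) =
      PowerSeries.constantCoeff (g (ofLex p.1).1) := by
  rw [evalForm_eq_sum, Finset.sum_eq_single (ofLex p.1)]
  · rw [coeff_branchMonomial_mul, if_pos ⟨rfl, le_rfl⟩, pivotForm_apply_self, one_smul,
      Nat.sub_self, PowerSeries.coeff_zero_eq_constantCoeff]
  · intro s hs hne
    rw [coeff_branchMonomial_mul, if_neg, smul_zero]
    rintro ⟨h1, h2⟩
    refine Finsupp.mem_support_iff.1 hs (pivotForm_apply_of_lt p (y := toLex s) ?_)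
    refine lt_of_le_of_ne ?_ fun h => hne (by rw [h]; rfl)
    rw [Prod.Lex.le_iff]
    exact Or.inr ⟨h1.symm, h2⟩
  · intro h
    rw [Finsupp.notMem_support_iff.1 h, zero_smul]

/-- The monomials at the pivots span a complement of `O_R`, also after multiplication by a unit. -/
theorem existsUnique_add_sum_mem_ringPoints [Fintype (Pivot O)] {R : Type u} [CommRing R]
    [Algebra k R] (z g : BranchRing d R) (hg : ∀ i, IsUnit (PowerSeries.constantCoeff (g i))) :
    ∃! s : Pivot O → R, z + ∑ q, s q • (branchMonomial R (ofLex q.1) * g) ∈ ringPoints O R := by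
  classical
  -- The unknowns s solve a linear system with this matrix, which is triangular with constant terms
  -- of g on the diagonal.
  let M : Matrix (Pivot O) (Pivot O) R :=
    .of fun p q => evalForm (pivotForm p) (branchMonomial R (ofLex q.1) * g)
  have hM : IsUnit M := by
    rw [Matrix.isUnit_iff_isUnit_det, Matrix.det_of_isLowerTriangular]
    · refine Finset.prod_induction _ IsUnit (fun _ _ => IsUnit.mul) isUnit_one fun p _ => ?_
      change IsUnit (evalForm _ _)
      rw [evalForm_pivotForm_self]
      exact hg _
    · intro p q h
      exact evalForm_pivotForm_of_lt h g
  have hiff : ∀ s : Pivot O → R, z + ∑ q, s q • (branchMonomial R (ofLex q.1) * g) ∈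
      ringPoints O R ↔ M.mulVec s = fun p => -evalForm (pivotForm p) z := by
    intro s
    rw [mem_ringPoints_iff_pivotForm, funext_iff]
    refine forall_congr' fun p => ?_
    have : evalForm (pivotForm p) (∑ q, s q • (branchMonomial R (ofLex q.1) * g)) =
        M.mulVec s p := by
      rw [Matrix.mulVec, dotProduct]
      have hsum : ∀ T : Finset (Pivot O),
          evalForm (pivotForm p) (∑ q ∈ T, s q • (branchMonomial R (ofLex q.1) * g)) =
            ∑ q ∈ T, M p q * s q := by
        intro T
        induction T using Finset.induction_on with
        | empty => simp [evalForm_eq_sum]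
        | insert q T hq ih =>
          rw [Finset.sum_insert hq, Finset.sum_insert hq, evalForm_add, ih, evalForm_mul_left,
            mul_comm]
          rfl
      exact hsum _
    rw [evalForm_add, this, add_comm, ← eq_neg_iff_add_eq_zero]
  simp only [hiff]
  obtain ⟨N, hN⟩ := hM
  refine ⟨(↑N⁻¹ : Matrix (Pivot O) (Pivot O) R).mulVec fun p => -evalForm (pivotForm p) z, ?_, ?_⟩
  · beta_reduce
    rw [Matrix.mulVec_mulVec, ← hN, Units.mul_inv, Matrix.one_mulVec]
  · intro s hs
    rw [← hs, Matrix.mulVec_mulVec, ← hN, Units.inv_mul, Matrix.one_mulVec]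

end Pivots

/-! ## The group `𝒥` -/

section GroupJ

variable {k : Type u} [Field k] {d : ℕ} {O : Subalgebra k (BranchRing d k)} {i₀ : Fin d}

theorem finite_pivot {c : Fin d → ℕ}
    (hO : ∀ l ∈ annihilatorForms O, ∀ i j, c i ≤ j → l (i, j) = 0) : Finite (Pivot O) := by
  have hlt : ∀ p : Pivot O, (ofLex p.1).2 < c (ofLex p.1).1 := by
    intro p
    by_contra h
    have h1 := hO _ (pivotForm_mem p) (ofLex p.1).1 (ofLex p.1).2 (not_lt.1 h)
    have h2 := pivotForm_apply_self p
    rw [Prod.mk.eta] at h1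
    exact zero_ne_one (h1.symm.trans h2)
  refine Finite.of_injective (β := Σ i : Fin d, Fin (c i))
    (fun p => ⟨(ofLex p.1).1, ⟨(ofLex p.1).2, hlt p⟩⟩) ?_
  rintro ⟨p, hp⟩ ⟨q, hq⟩ h
  obtain ⟨⟨i, j⟩, rfl⟩ := toLex.surjective p
  obtain ⟨⟨i', j'⟩, rfl⟩ := toLex.surjective q
  simp only [ofLex_toLex, Sigma.mk.injEq] at h
  obtain ⟨rfl, h⟩ := h
  simp only [heq_eq_eq, Fin.mk.injEq] at h
  subst h
  rfl

theorem toLex_zero_le (hi₀ : ∀ i, i₀ ≤ i) (y : Fin d ×ₗ ℕ) : toLex (i₀, 0) ≤ y := by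
  rw [Prod.Lex.le_iff]
  rcases (hi₀ (ofLex y).1).lt_or_eq with h | h
  · exact Or.inl h
  · exact Or.inr ⟨h, Nat.zero_le _⟩

/-- The index (i₀, 0) is the least one, so a form with this pivot would be the single coefficient
there, which does not vanish at 1 ∈ O. -/
theorem not_isPivot_zero (hi₀ : ∀ i, i₀ ≤ i) : ¬ IsPivot O (toLex (i₀, 0)) := by
  rintro ⟨l, hl, h1, h2⟩
  have h3 := hl 1 O.one_mem
  rw [evalForm_eq_sum, Finset.sum_eq_single (i₀, 0)] at h3
  · simp only [ofLex_toLex] at h1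
    simp [h1] at h3
  · intro p hp hne
    refine absurd (h2 (toLex p) ?_) (Finsupp.mem_support_iff.1 hp)
    exact lt_of_le_of_ne (toLex_zero_le hi₀ _) fun h => hne (toLex.injective h).symm
  · intro h
    rw [Finsupp.notMem_support_iff.1 h, zero_smul]

theorem isPivot_of_ne [IsLocalRing O] (hi₀ : ∀ i, i₀ ≤ i) {i : Fin d} (hi : i ≠ i₀) :
    IsPivot O (toLex (i, 0)) := by
  have hlt : (toLex (i₀, 0) : Fin d ×ₗ ℕ) < toLex (i, 0) :=
    lt_of_le_of_ne (toLex_zero_le hi₀ _) fun h => hi (Prod.ext_iff.1 (toLex.injective h)).1.symm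
  refine ⟨_, single_sub_single_mem_annihilatorForms i i₀, ?_, fun y hy => ?_⟩
  · simp [hi.symm]
  · have h1 : (i, 0) ≠ ofLex y := fun h => hy.ne (by rw [h]; rfl)
    have h2 : (i₀, 0) ≠ ofLex y := fun h => (hlt.trans hy).ne (by rw [h]; rfl)
    simp [h1, h2]

/-- The pivots of degree `0`. -/
def zeroPivot [IsLocalRing O] (hi₀ : ∀ i, i₀ ≤ i) (i : {i // i ≠ i₀}) : Pivot O :=
  ⟨toLex (i.1, 0), isPivot_of_ne hi₀ i.2⟩

theorem zeroPivot_injective [IsLocalRing O] (hi₀ : ∀ i, i₀ ≤ i) :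
    Function.Injective (zeroPivot (O := O) hi₀) := by
  intro i j h
  exact Subtype.ext (Prod.ext_iff.1 (toLex.injective (Subtype.ext_iff.1 h))).1

/-- A system of representatives of `𝒥`. -/
noncomputable def pivotSection {R : Type u} [CommRing R] [Fintype (Pivot O)] (i₀ : Fin d)
    (s : Pivot O → R) : BranchRing d R :=
  branchMonomial R (i₀, 0) + ∑ q, s q • branchMonomial R (ofLex q.1)

/-- The torus times affine space isomorphic to `𝒥`. -/
noncomputable def groupCondition [IsLocalRing O] (hi₀ : ∀ i, i₀ ≤ i) :
    BasicCondition k (Pivot O) :=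
  (torusCondition k {i // i ≠ i₀}).rename (zeroPivot hi₀)

theorem aeval_groupCondition_q [IsLocalRing O] (hi₀ : ∀ i, i₀ ≤ i) {R : Type u} [CommRing R]
    [Algebra k R] (s : Pivot O → R) :
    MvPolynomial.aeval s (groupCondition hi₀).q = ∏ i, s (zeroPivot hi₀ i) := by
  change MvPolynomial.aeval s (MvPolynomial.rename (zeroPivot hi₀) (∏ i, MvPolynomial.X i)) = _
  simp [map_prod]

/-- Yoneda: ψ ∘ φ and the identity both classify the universal unit w, and the classifying map is
unique. -/
theorem RepresentsJ.comp_eq_id {A A' : Type u} [CommRing A] [Algebra k A] [CommRing A']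
    [Algebra k A'] {w : (BranchRing d A)ˣ} {w' : (BranchRing d A')ˣ}
    (hw : ∀ g : (BranchRing d A)ˣ, ∃! φ : A →ₐ[k] A, ∃ h : (BranchRing d A)ˣ,
      (h : BranchRing d A) ∈ ringPoints O A ∧
      ((h⁻¹ : (BranchRing d A)ˣ) : BranchRing d A) ∈ ringPoints O A ∧
      g = Units.map (coeffMap d φ : BranchRing d A →* BranchRing d A) w * h)
    {φ : A →ₐ[k] A'} {ψ : A' →ₐ[k] A}
    (hφ : ∃ h : (BranchRing d A')ˣ, (h : BranchRing d A') ∈ ringPoints O A' ∧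
      ((h⁻¹ : (BranchRing d A')ˣ) : BranchRing d A') ∈ ringPoints O A' ∧
      w' = Units.map (coeffMap d φ : BranchRing d A →* BranchRing d A') w * h)
    (hψ : ∃ h : (BranchRing d A)ˣ, (h : BranchRing d A) ∈ ringPoints O A ∧
      ((h⁻¹ : (BranchRing d A)ˣ) : BranchRing d A) ∈ ringPoints O A ∧
      w = Units.map (coeffMap d ψ : BranchRing d A' →* BranchRing d A) w' * h) :
    ψ.comp φ = AlgHom.id k A := by
  obtain ⟨h, h1, h2, rfl⟩ := hφ
  obtain ⟨h', h1', h2', he⟩ := hψ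
  refine (hw w).unique ⟨Units.map (coeffMap d ψ : BranchRing d A' →* BranchRing d A) h * h', ?_, ?_,
    ?_⟩ ⟨1, one_mem_ringPoints, by rw [inv_one]; exact one_mem_ringPoints, ?_⟩
  · rw [Units.val_mul]
    exact mul_mem_ringPoints (coeffMap_mem_ringPoints ψ h1) h1'
  · rw [mul_inv_rev, Units.val_mul, ← map_inv]
    exact mul_mem_ringPoints h2' (coeffMap_mem_ringPoints ψ h2)
  · conv_lhs => rw [he, map_mul, mul_assoc]
    rfl
  · rw [mul_one]
    ext i j
    rfl

theorem RepresentsJ.nonempty_algEquiv {A A' : Type u} [CommRing A] [Algebra k A] [CommRing A']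
    [Algebra k A'] (h : RepresentsJ O A) (h' : RepresentsJ O A') : Nonempty (A ≃ₐ[k] A') := by
  obtain ⟨w, hw⟩ := h
  obtain ⟨w', hw'⟩ := h'
  obtain ⟨φ, hφ, -⟩ := hw A' w'
  obtain ⟨ψ, hψ, -⟩ := hw' A w
  exact ⟨AlgEquiv.ofAlgHom φ ψ (RepresentsJ.comp_eq_id (hw' A') hψ hφ)
    (RepresentsJ.comp_eq_id (hw A) hφ hψ)⟩

variable [Fintype (Pivot O)]

open Classical in
theorem coeff_pivotSection {R : Type u} [CommRing R] (s : Pivot O → R) (i : Fin d) (j : ℕ) :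
    PowerSeries.coeff j (pivotSection i₀ s i) = (if (i₀, 0) = (i, j) then 1 else 0) +
      if h : IsPivot O (toLex (i, j)) then s ⟨_, h⟩ else 0 := by
  rw [pivotSection, Pi.add_apply, map_add, branchMonomial, coeff_single_X_pow, Finset.sum_apply,
    map_sum]
  congr 1
  have h1 : ∀ q : Pivot O, PowerSeries.coeff j ((s q • branchMonomial R (ofLex q.1)) i) =
      if ofLex q.1 = (i, j) then s q else 0 := by
    intro q
    rw [Pi.smul_apply, PowerSeries.coeff_smul, branchMonomial, coeff_single_X_pow, smul_eq_mul,
      mul_ite, mul_one, mul_zero]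
  rw [Finset.sum_congr rfl fun q _ => h1 q]
  split_ifs with h
  · rw [Finset.sum_eq_single ⟨toLex (i, j), h⟩]
    · rw [if_pos (ofLex_toLex _)]
    · intro q _ hq
      rw [if_neg]
      intro h'
      exact hq (Subtype.ext (congrArg toLex h'))
    · simp
  · refine Finset.sum_eq_zero fun q _ => if_neg fun h' => h ?_
    rw [← h']
    exact q.2

theorem constantCoeff_pivotSection_self {R : Type u} [CommRing R] (hi₀ : ∀ i, i₀ ≤ i)
    (s : Pivot O → R) : PowerSeries.constantCoeff (pivotSection i₀ s i₀) = 1 := by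
  rw [← PowerSeries.coeff_zero_eq_constantCoeff_apply, coeff_pivotSection, if_pos rfl,
    dif_neg (not_isPivot_zero hi₀), add_zero]

theorem constantCoeff_pivotSection [IsLocalRing O] {R : Type u} [CommRing R] (hi₀ : ∀ i, i₀ ≤ i)
    (s : Pivot O → R) (i : {i // i ≠ i₀}) :
    PowerSeries.constantCoeff (pivotSection i₀ s i) = s (zeroPivot hi₀ i) := by
  rw [← PowerSeries.coeff_zero_eq_constantCoeff_apply, coeff_pivotSection, if_neg,
    dif_pos (isPivot_of_ne hi₀ i.2), zero_add]
  · rfl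
  · intro h
    exact i.2 (Prod.ext_iff.1 h).1.symm

/-- The unit is the sum of the idempotents of all branches, and those of branches other than i₀ are
pivot monomials. -/
theorem exists_pivotSection_eq_one [IsLocalRing O] (R : Type u) [CommRing R]
    (hi₀ : ∀ i, i₀ ≤ i) : ∃ s : Pivot O → R, pivotSection i₀ s = 1 := by
  classical
  refine ⟨fun q => if (ofLex q.1).2 = 0 then 1 else 0, ?_⟩
  ext i j
  rw [coeff_pivotSection, Pi.one_apply, PowerSeries.coeff_one]
  by_cases hj : j = 0
  · subst hj
    by_cases hi : i = i₀
    · subst hi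
      rw [if_pos rfl, dif_neg (not_isPivot_zero hi₀), add_zero, if_pos rfl]
    · rw [if_neg fun h => hi (Prod.ext_iff.1 h).1.symm, dif_pos (isPivot_of_ne hi₀ hi), zero_add]
      simp
  · rw [if_neg fun h => hj (Prod.ext_iff.1 h).2.symm, zero_add, if_neg hj]
    simp [hj]

theorem coeffMap_pivotSection {A R : Type u} [CommRing A] [Algebra k A] [CommRing R] [Algebra k R]
    (φ : A →ₐ[k] R) (s : Pivot O → A) :
    coeffMap d φ (pivotSection i₀ s) = pivotSection i₀ fun q => φ (s q) := by
  classical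
  ext i j
  change φ (PowerSeries.coeff j (pivotSection i₀ s i)) = _
  rw [coeff_pivotSection, coeff_pivotSection, map_add]
  congr 1
  · split_ifs <;> simp
  · split_ifs <;> simp

theorem isUnit_constantCoeff {R : Type u} [CommRing R] (g : (BranchRing d R)ˣ) (i : Fin d) :
    IsUnit (PowerSeries.constantCoeff ((g : BranchRing d R) i)) :=
  (g.isUnit.map (Pi.evalRingHom _ i)).map PowerSeries.constantCoeff

theorem existsUnique_pivotSection_mul_mem {R : Type u} [CommRing R] [Algebra k R] (i₀ : Fin d)
    (g : (BranchRing d R)ˣ) :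
    ∃! s : Pivot O → R, pivotSection i₀ s * (g : BranchRing d R) ∈ ringPoints O R := by
  have h := existsUnique_add_sum_mem_ringPoints (O := O)
    (branchMonomial R (i₀, 0) * (g : BranchRing d R))
    (g : BranchRing d R) (isUnit_constantCoeff g)
  simpa only [pivotSection, add_mul, Finset.sum_mul, smul_mul_assoc] using h

/-- Some section value S has S * g⁻¹ ∈ O_R, so S ∈ O_R after multiplication by g. The section value
1 is also in O_R, and uniqueness forces S = 1. -/
theorem inv_mem_ringPoints [IsLocalRing O] {R : Type u} [CommRing R] [Algebra k R]
    (hi₀ : ∀ i, i₀ ≤ i) {g : (BranchRing d R)ˣ} (hg : (g : BranchRing d R) ∈ ringPoints O R) :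
    ((g⁻¹ : (BranchRing d R)ˣ) : BranchRing d R) ∈ ringPoints O R := by
  obtain ⟨s, hs, -⟩ := existsUnique_pivotSection_mul_mem (O := O) i₀ g⁻¹
  obtain ⟨s₁, hs₁⟩ := exists_pivotSection_eq_one (O := O) R hi₀
  have h1 : pivotSection i₀ s * ((1 : (BranchRing d R)ˣ) : BranchRing d R) ∈ ringPoints O R := by
    have := mul_mem_ringPoints hs hg
    rwa [mul_assoc, Units.inv_mul, ← Units.val_one] at this
  have h2 : pivotSection i₀ s₁ * ((1 : (BranchRing d R)ˣ) : BranchRing d R) ∈ ringPoints O R := by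
    rw [hs₁, Units.val_one, mul_one]
    exact one_mem_ringPoints
  have h3 := (existsUnique_pivotSection_mul_mem (O := O) i₀ (1 : (BranchRing d R)ˣ)).unique h1 h2
  rwa [h3, hs₁, one_mul] at hs

theorem isUnit_pivotSection_iff [IsLocalRing O] (hi₀ : ∀ i, i₀ ≤ i) {R : Type u} [CommRing R]
    [Algebra k R] (s : Pivot O → R) :
    IsUnit (pivotSection i₀ s) ↔ IsUnit (MvPolynomial.aeval s (groupCondition hi₀).q) := by
  rw [aeval_groupCondition_q, Pi.isUnit_iff, IsUnit.prod_iff]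
  simp only [PowerSeries.isUnit_iff_constantCoeff]
  constructor
  · intro h i _
    rw [← constantCoeff_pivotSection hi₀ s i]
    exact h i
  · intro h i
    by_cases hi : i = i₀
    · rw [hi, constantCoeff_pivotSection_self hi₀]
      exact isUnit_one
    · have := h ⟨i, hi⟩ (Finset.mem_univ _)
      rwa [← constantCoeff_pivotSection hi₀ s ⟨i, hi⟩] at this

theorem representsJ_groupCondition [IsLocalRing O] (hi₀ : ∀ i, i₀ ≤ i) :
    RepresentsJ O (groupCondition (O := O) hi₀).coordRing := by
  let D := groupCondition (O := O) hi₀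
  let x : Pivot O → D.coordRing := fun q => D.toCoordRing (MvPolynomial.X q)
  have hx : MvPolynomial.aeval x D.q = D.toCoordRing D.q := by
    rw [← MvPolynomial.comp_aeval_apply, MvPolynomial.aeval_X_left, AlgHom.id_apply]
  have hS : IsUnit (pivotSection i₀ x) := by
    rw [isUnit_pivotSection_iff hi₀, hx]
    exact D.isUnit_toCoordRing
  obtain ⟨S, hS⟩ := hS
  -- The universal unit is the inverse of the section, since g = S⁻¹ * h with h ∈ O_R amounts to S *
  -- g ∈ O_R.
  refine ⟨S⁻¹, fun R _ _ g => ?_⟩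
  have hSφ : ∀ φ : D.coordRing →ₐ[k] R,
      ((Units.map (coeffMap d φ : BranchRing d D.coordRing →* BranchRing d R) S :
        (BranchRing d R)ˣ) : BranchRing d R) = pivotSection i₀ fun q => φ (x q) := by
    intro φ
    rw [← coeffMap_pivotSection, ← hS]
    rfl
  have hiff : ∀ φ : D.coordRing →ₐ[k] R, (∃ h : (BranchRing d R)ˣ,
      (h : BranchRing d R) ∈ ringPoints O R ∧
      ((h⁻¹ : (BranchRing d R)ˣ) : BranchRing d R) ∈ ringPoints O R ∧
      g = Units.map (coeffMap d φ : BranchRing d D.coordRing →* BranchRing d R) S⁻¹ * h) ↔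
      pivotSection i₀ (fun q => φ (x q)) * (g : BranchRing d R) ∈ ringPoints O R := by
    intro φ
    rw [← hSφ, ← Units.val_mul]
    constructor
    · rintro ⟨h, h1, -, rfl⟩
      rwa [map_inv, mul_inv_cancel_left]
    · intro h
      exact ⟨_, h, inv_mem_ringPoints hi₀ h, by rw [map_inv, inv_mul_cancel_left]⟩
  obtain ⟨s, hs, huniq⟩ := existsUnique_pivotSection_mul_mem (O := O) i₀ g
  -- Elements of O_R have the same constant term on all branches. For the product with g it is the
  -- constant term of g on i₀, a unit, so the section is invertible on every branch.
  have hunit : IsUnit (pivotSection i₀ s) := by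
    refine Pi.isUnit_iff.2 fun i => PowerSeries.isUnit_iff_constantCoeff.2 ?_
    have h1 := constantCoeff_eq_of_mem_ringPoints hs i i₀
    rw [Pi.mul_apply, Pi.mul_apply, map_mul, map_mul, constantCoeff_pivotSection_self hi₀,
      one_mul] at h1
    have h2 := isUnit_constantCoeff g i₀
    rw [← h1] at h2
    exact isUnit_of_mul_isUnit_left h2
  obtain ⟨φ, hφ⟩ := D.exists_coordRing_lift s (by
      intro p hp
      change p ∈ Ideal.map _ (⊥ : Ideal _) at hp
      rw [Ideal.map_bot, Ideal.mem_bot] at hp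
      rw [hp, map_zero]) ((isUnit_pivotSection_iff hi₀ s).1 hunit)
  have hφ' : (fun q => φ (x q)) = s := funext fun q => by rw [hφ, MvPolynomial.aeval_X]
  refine ⟨φ, (hiff φ).2 (by rwa [hφ']), fun ψ hψ => D.coordRing_algHom_ext fun q => ?_⟩
  have := huniq _ ((hiff ψ).1 hψ)
  rw [← hφ'] at this
  exact congrFun this q

/-- For R = k and g = 1, the unique solvability says that the pivot monomials form a basis of the
full ring modulo O. -/
theorem singularityDegree_eq_card_pivot
    (hfin : Module.Finite k (BranchRing d k ⧸ Subalgebra.toSubmodule O)) {c : Fin d → ℕ}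
    (hc : ∀ n, c ≤ n → n ∈ valueSemigroup O) : singularityDegree O = Nat.card (Pivot O) := by
  have h := fun z => existsUnique_add_sum_mem_ringPoints (O := O) z (1 : BranchRing d k)
    fun i => by rw [Pi.one_apply, map_one]; exact isUnit_one
  simp only [mul_one, mem_ringPoints_self hfin hc] at h
  let Ψ : (Pivot O → k) →ₗ[k] BranchRing d k := Fintype.linearCombination k
    fun q : Pivot O => branchMonomial k (ofLex q.1)
  have hΨ : ∀ s, Ψ s = ∑ q, s q • branchMonomial k (ofLex q.1) := fun s => rfl
  simp only [← hΨ] at h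
  have hbij : Function.Bijective ((Submodule.mkQ (Subalgebra.toSubmodule O)).comp Ψ) := by
    constructor
    · intro s s' hss
      have h1 : Ψ s - Ψ s' ∈ O := (Submodule.Quotient.eq _).1 hss
      refine (h (-Ψ s')).unique ?_ ?_
      · rwa [neg_add_eq_sub]
      · rw [neg_add_cancel]
        exact O.zero_mem
    · intro y
      obtain ⟨z, rfl⟩ := Submodule.mkQ_surjective _ y
      obtain ⟨s, hs, -⟩ := h (-z)
      refine ⟨s, (Submodule.Quotient.eq _).2 ?_⟩
      rwa [neg_add_eq_sub] at hs
  rw [singularityDegree, ← (LinearEquiv.ofBijective _ hbij).finrank_eq, Module.finrank_fintype_fun_eq_card,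
    Nat.card_eq_fintype_card]

theorem cls_of_representsJ [IsLocalRing O] (hi₀ : ∀ i, i₀ ≤ i) {A : Type u} [CommRing A]
    [Algebra k A] [Algebra.FiniteType k A] (hA : RepresentsJ O A) :
    (KVariety.affine k A).cls = (torusCondition k {i // i ≠ i₀}).cls *
      affineLineClass k ^ (Nat.card (Pivot O) - (d - 1)) := by
  have := (groupCondition (O := O) hi₀).finiteType_coordRing
  obtain ⟨e⟩ := hA.nonempty_algEquiv (representsJ_groupCondition (O := O) hi₀)
  rw [KVariety.cls_affine_congr e]
  have h := BasicCondition.cls_rename (torusCondition k {i // i ≠ i₀})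
    (zeroPivot_injective (O := O) hi₀)
  have hcard : Nat.card {i // i ≠ i₀} = d - 1 := by
    rw [Nat.card_eq_fintype_card, Fintype.card_subtype_compl]
    simp
  rw [hcard] at h
  exact h

end GroupJ

/-! ## The generalized Poincaré series -/

section Strata

variable {k : Type u} [Field k] {d : ℕ} {O : Subalgebra k (BranchRing d k)} {c : Fin d → ℕ}
  {K : Type u} [Field K] [IsAlgClosed K] [Algebra k K]

/-- The class of normalized jets is unchanged while the jet space gains one coordinate, which costs
one factor 𝕃⁻¹. -/
theorem genEulerChar_valueStratum_add_single
    (hO : ∀ l ∈ annihilatorForms O, ∀ i j, c i ≤ j → l (i, j) = 0) (i₀ a : Fin d)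
    {n : Fin d → ℕ} (ha : c a ≤ n a) :
    genEulerChar k (valueStratum O K (n + Pi.single a 1)) =
      (((lefschetz k)⁻¹ : (MotivicRing k)ˣ) : MotivicRing k) *
        genEulerChar k (valueStratum O K n) := by
  have hc : c ≤ n ⊔ c := le_sup_right
  have hn : n ≤ n ⊔ c := le_sup_left
  rw [(hasMotivicMeasure_valueStratum (K := K) hO i₀ (hc.trans le_self_add)
    (add_le_add_left hn (Pi.single a 1))).genEulerChar_eq,
    (hasMotivicMeasure_valueStratum (K := K) hO i₀ hc hn).genEulerChar_eq,
    cls_valueCondition_add_single hO i₀ a ha, mul_left_comm, ← Units.val_mul, ← pow_succ']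
  congr 3
  simp only [Pi.add_apply, Finset.sum_add_distrib, Finset.sum_pi_single', Finset.mem_univ, if_true]
  omega

theorem genEulerChar_valueStratum_conductor
    (hO : ∀ l ∈ annihilatorForms O, ∀ i j, c i ≤ j → l (i, j) = 0) (i₀ : Fin d) :
    genEulerChar k (valueStratum O K c) = toMotivic k (torusCondition k {i // i ≠ i₀}).cls *
      (((lefschetz k)⁻¹ ^ (∑ i, (c i + 1)) : (MotivicRing k)ˣ) : MotivicRing k) := by
  rw [(hasMotivicMeasure_valueStratum (K := K) hO i₀ le_rfl le_rfl).genEulerChar_eq,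
    cls_valueCondition_conductor hO]

end Strata

theorem corollary6 {k : Type u} [Field k] {d : ℕ}
    (O : Subalgebra k (BranchRing d k)) [IsLocalRing O]
    (hfin : Module.Finite k (BranchRing d k ⧸ Subalgebra.toSubmodule O))
    (c : Fin d → ℕ)
    (hc : Minimal (fun c : Fin d → ℕ => ∀ n, c ≤ n → n ∈ valueSemigroup O) c)
    (K : Type u) [Field K] [IsAlgClosed K] [Algebra k K] :
    IsMotivicIntegrable k (projRing O K) valMonomial ∧
    (∃ (A : Type u) (_ : CommRing A) (_ : Algebra k A),
      Algebra.FiniteType k A ∧ RepresentsJ O A) ∧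
    ∃ Q : MvPolynomial (Fin d) (MotivicRing k),
      genPoincareSeries O K *
          ∏ i, (1 - MvPowerSeries.C (((lefschetz k)⁻¹ : (MotivicRing k)ˣ) : MotivicRing k) *
            MvPowerSeries.X i) =
        (Q : MvPowerSeries (Fin d) (MotivicRing k)) ∧
      Q.totalDegree ≤ ∑ i, c i ∧
      ∀ (A : Type u) [CommRing A] [Algebra k A] [Algebra.FiniteType k A], RepresentsJ O A →
        MvPolynomial.eval (fun _ => ((lefschetz k : (MotivicRing k)ˣ) : MotivicRing k)) Q =
          ((lefschetz k ^ (-(singularityDegree O : ℤ) - 1) : (MotivicRing k)ˣ) : MotivicRing k) *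
            toMotivic k (KVariety.affine k A).cls := by

  have hc := hc.prop
  have hO : ∀ l ∈ annihilatorForms O, ∀ i j, c i ≤ j → l (i, j) = 0 :=
    fun l hl i j hj => apply_eq_zero_of_mem_annihilatorForms hfin hc hl hj
  -- Without branches the ring would be zero, which is not local.
  have hd : 0 < d := by
    rcases Nat.eq_zero_or_pos d with rfl | h
    · have : Subsingleton O := Subtype.val_injective.subsingleton
      exact absurd (inferInstance : Nontrivial O) (not_nontrivial O)
    · exact h
  -- The normalizing branch is the first one, so that (i₀, 0) is the least index in the
  -- lexicographic order.
  let i₀ : Fin d := ⟨0, hd⟩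
  have hi₀ : ∀ i, i₀ ≤ i := fun i => Nat.zero_le _
  have := finite_pivot hO
  have := Fintype.ofFinite (Pivot O)
  refine ⟨isMotivicIntegrable_valMonomial fun n => ⟨_, hasMotivicMeasure_valueStratum hO i₀
    (N := n ⊔ c) le_sup_right le_sup_left⟩, ⟨(groupCondition (O := O) hi₀).coordRing,
    inferInstance, inferInstance, BasicCondition.finiteType_coordRing _,
    representsJ_groupCondition hi₀⟩, ?_⟩
  obtain ⟨Q, hQ, hdeg, heval⟩ := exists_mvPolynomial_of_step (lefschetz k)
    (P := genPoincareSeries O K) (c := Finsupp.equivFunOnFinite.symm c)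
    (χ := fun n => genEulerChar k (valueStratum O K n)) (fun n => genPoincareSeries_apply n)
    (fun n a ha => by
      rw [Finsupp.coe_add, Finsupp.single_eq_pi_single]
      exact genEulerChar_valueStratum_add_single hO i₀ a ha)
  refine ⟨Q, hQ, hdeg.trans (by simp [Finsupp.degree_eq_sum]), fun A _ _ _ hA => ?_⟩
  -- The d - 1 pivots of degree 0 are among the δ pivots, so the exponent δ - (d - 1) is not
  -- truncated.
  have hcard : d - 1 ≤ singularityDegree O := by
    rw [singularityDegree_eq_card_pivot hfin hc]
    have h := Nat.card_le_card_of_injective _ (zeroPivot_injective (O := O) hi₀)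
    rwa [Nat.card_eq_fintype_card, Fintype.card_subtype_compl, Fintype.card_fin,
      Fintype.card_subtype_eq] at h
  rw [heval, Finsupp.coe_equivFunOnFinite_symm, genEulerChar_valueStratum_conductor hO i₀,
    cls_of_representsJ hi₀ hA, ← singularityDegree_eq_card_pivot hfin hc, map_mul, map_pow,
    toMotivic_affineLineClass, mul_left_comm, mul_left_comm _ (toMotivic k _),
    ← Units.val_pow_eq_pow_val, ← Units.val_pow_eq_pow_val, ← Units.val_mul, ← Units.val_mul]
  congr 2
  -- Only the powers of 𝕃 remain to be compared: ‖c‖ - (‖c‖ + d) and (-δ - 1) + (δ - (d - 1)) are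
  -- both -d.
  obtain ⟨r, hr⟩ := Nat.exists_eq_add_of_le hcard
  obtain ⟨e, rfl⟩ := Nat.exists_eq_succ_of_ne_zero hd.ne'
  rw [hr, Finsupp.degree_eq_sum, ← zpow_natCast, ← zpow_natCast, ← zpow_natCast, inv_zpow',
    ← zpow_add, ← zpow_add]
  congr 1
  simp [Finset.sum_add_distrib]
  ring
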